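/- Let $X_1,X_2,\dots$ be independent random variables with $\mathbb{P}(X_k=1)=\mathbb{P}(X_k=-1)=\tfrac12$ for every $k\ge 1$. Let $c>0$, put $a_k=c\ln k$ for $k\ge 1$ (equivalently, $a_k=\log_\gamma k$ with $\gamma=e^{1/c}>1$), and let $S(n)=\sum_{k=1}^n a_kX_k$, $S(0)=0$, be the corresponding walk. Then almost surely the walk is $C$-recurrent for every $C>0$; that is, with probability one, for every real $C>0$ the inequality $|S(n)|\le C$ holds for infinitely many $n$. -/

import Mathlib

open MeasureTheory ProbabilityTheory Filter

namespace AWalk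

variable {Ω : Type*} [MeasurableSpace Ω]

/-- `Y` is a random variable with `P(Y = 1) = P(Y = -1) = 1/2`. -/
structure IsRademacher (Y : Ω → ℝ) (μ : Measure Ω) : Prop where
  measurable : Measurable Y
  prob_one : μ {ω | Y ω = 1} = 1 / 2
  prob_neg_one : μ {ω | Y ω = -1} = 1 / 2

/-- `X 1, X 2, …` are i.i.d. Rademacher variables. The value `X 0` plays no role. -/
structure IsRademacherSequence (X : ℕ → Ω → ℝ) (μ : Measure Ω) : Prop where
  rademacher : ∀ k : ℕ, 1 ≤ k → IsRademacher (X k) μ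
  indep : iIndepFun (fun k : ℕ => X (k + 1)) μ

/-- The `a`-walk `S(n) = a₁ X₁ + ⋯ + aₙ Xₙ`, with `S(0) = 0`. -/
def walk {Ω : Type*} (a : ℕ → ℝ) (X : ℕ → Ω → ℝ) (n : ℕ) (ω : Ω) : ℝ :=
  ∑ k ∈ Finset.Icc 1 n, a k * X k ω

/-- The path `s` is `C`-recurrent: `|s n| ≤ C` for infinitely many `n`. -/
def IsCRecurrent (C : ℝ) (s : ℕ → ℝ) : Prop :=
  {n : ℕ | |s n| ≤ C}.Infinite

end AWalk

namespace AWalk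

/-! After division by `c` the steps are `log (k + 1)`. The core is `exists_hitting_bound`: from any
bounded position at any time, the walk enters `[-C, C]` in a later window with probability at least
`δ`, where `δ` depends on neither the position nor the time. Chaining such windows
(`exists_measureReal_no_visit_le`) bounds the probability of no visit after time `m` by `(1 - δ) ^
i` for every `i`, so it is zero.

The hitting bound is a second-moment argument. Let `R` be the sum over `2N ≤ n < 4N` of a bump `φ`
evaluated at the walk. At such times the standard deviation has order `√N log N`, so the mean of `R`
should have order `√N / log N` (`IsFourierBump.le_integral_increment`). After any visit, the
expected number of further visits in the window has at most this order (`sum_smallBallBound_le`), so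
the second moment of `R` is at most a multiple of `√N / log N` times its mean, and `R ≠ 0` with
probability bounded below.

Both estimates come from Fourier inversion, which turns the mean of `φ` into an integral against `∏
cos (t log (k + 1))`. For `|t| ≤ 1 / log (4N)` the product is Gaussian in size. Up to `N / 4` it is
at most `1 / N`: the logarithms vary slowly enough that the phases `t log (k + 1)` cannot all stay
near `πℤ`. Beyond that, the decay of `ψ` suffices. The middle range needs increments of length at
least `N ^ (3/4)`; for shorter ones the Littlewood-Offord bound `1 / √j` is enough. Any exponent
strictly between `2/3` and `1` would serve. -/

/-! ### Smooth bumps and Fourier inversion. -/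

/-- A nonnegative bump `φ` supported in `[-C, C]`, together with an integrable `ψ` of which it is
the inverse Fourier transform. -/
structure IsFourierBump (C : ℝ) (φ : ℝ → ℝ) (ψ : ℝ → ℂ) : Prop where
  continuous : Continuous φ
  nonneg : ∀ s, 0 ≤ φ s
  le_one : ∀ s, φ s ≤ 1
  abs_le_of_ne_zero : ∀ s, φ s ≠ 0 → |s| ≤ C
  continuous_fourier : Continuous ψ
  integrable : Integrable ψ
  integrable_mul : Integrable fun t => |t| * ‖ψ t‖
  bounded : ∃ B, 0 < B ∧ ∀ t, ‖ψ t‖ ≤ B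
  re_pos : 0 < (ψ 0).re
  inversion : ∀ s, (φ s : ℂ) = ∫ t, ψ t * Complex.exp (t * s * Complex.I)

-- A smooth bump is Schwartz, hence so is its Fourier transform, which gives all the decay. At `0`
-- the transform is the integral of the bump, hence positive.
open FourierTransform in
theorem exists_isFourierBump {C : ℝ} (hC : 0 < C) : ∃ φ ψ, IsFourierBump C φ ψ := by
  let β : ContDiffBump (0 : ℝ) := ⟨C / 2, C, by positivity, by linarith⟩
  have h1 : HasCompactSupport (fun x => ((β x : ℝ) : ℂ)) :=
    β.hasCompactSupport.comp_left (g := fun x : ℝ => (x : ℂ)) (by simp)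
  have h2 : ContDiff ℝ (⊤ : ℕ∞) (fun x => ((β x : ℝ) : ℂ)) :=
    Complex.ofRealCLM.contDiff.comp β.contDiff
  let f : SchwartzMap ℝ ℂ := h1.toSchwartzMap h2
  have hf : ∀ x, f x = ((β x : ℝ) : ℂ) := fun x => rfl
  let g : SchwartzMap ℝ ℂ := 𝓕 f
  have hp : (0 : ℝ) < 2 * Real.pi := by positivity
  have hp1 : ((2 * Real.pi)⁻¹ : ℝ) ≠ 0 := by positivity
  -- The rescaling passes from the kernel `exp (2πivs)` to `exp (its)`; the outer factor is the
  -- Jacobian.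
  let ψ : ℝ → ℂ := fun t => ((2 * Real.pi)⁻¹ : ℝ) * g ((2 * Real.pi)⁻¹ * t)
  have hinv : ∀ s, f s = ∫ v, Complex.exp (((2 * Real.pi * v * s : ℝ) : ℂ) * Complex.I) * g v := by
    intro s
    have h3 : f = 𝓕⁻ g := (FourierTransform.fourierInv_fourier_eq f).symm
    have h4 : f s = 𝓕⁻ (g : ℝ → ℂ) s := by
      rw [← SchwartzMap.fourierInv_coe, ← h3]
    rw [h4, Real.fourierInv_eq']
    refine integral_congr_ae (Eventually.of_forall fun v => ?_)
    simp only [smul_eq_mul]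
    congr 3
    simp [inner]; ring
  have hψi : Integrable ψ := (g.integrable.comp_mul_left' hp1).const_mul _
  refine ⟨β, ψ, ⟨β.continuous, fun s => β.nonneg, fun s => β.le_one, ?_, ?_, hψi, ?_, ?_, ?_, ?_⟩⟩
  · intro s hs
    have : s ∈ Function.support β := hs
    rw [β.support_eq] at this
    have h5 : |s| < C := by simpa using this
    exact h5.le
  · have := g.continuous
    fun_prop
  · have h6 := (g.integrable_pow_mul volume 1).comp_mul_left' hp1
    refine h6.congr (Eventually.of_forall fun t => ?_)
    have h7 : |Real.pi| = Real.pi := abs_of_pos Real.pi_pos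
    simp [ψ, h7]
    ring
  · obtain ⟨B, hB⟩ := g.decay 0 0
    refine ⟨(2 * Real.pi)⁻¹ * B, by have := hB.1; positivity, fun t => ?_⟩
    have h8 := hB.2 ((2 * Real.pi)⁻¹ * t)
    simp only [pow_zero, one_mul, norm_iteratedFDeriv_zero] at h8
    simp only [ψ, norm_mul, Complex.norm_real, Real.norm_eq_abs]
    rw [abs_of_pos (by positivity)]
    gcongr
  · have h9 : g 0 = ((∫ x, β x : ℝ) : ℂ) := by
      have : g 0 = 𝓕 (f : ℝ → ℂ) 0 := by rw [← SchwartzMap.fourier_coe]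
      rw [this, Real.fourier_eq']
      simp [hf, integral_complex_ofReal]
    have h10 : 0 < ∫ x, β x := β.integral_pos
    simp only [ψ, mul_zero, h9]
    rw [← Complex.ofReal_mul, Complex.ofReal_re]
    positivity
  · intro s
    rw [← hf, hinv s]
    have h11 := Measure.integral_comp_mul_left
      (fun v : ℝ => Complex.exp (((2 * Real.pi * v * s : ℝ) : ℂ) * Complex.I) * g v)
      ((2 * Real.pi)⁻¹)
    rw [inv_inv, abs_of_pos hp] at h11
    have h12 : (∫ v, Complex.exp (((2 * Real.pi * v * s : ℝ) : ℂ) * Complex.I) * g v)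
        = ((2 * Real.pi)⁻¹ : ℝ) • ((2 * Real.pi) • ∫ v,
          Complex.exp (((2 * Real.pi * v * s : ℝ) : ℂ) * Complex.I) * g v) := by
      rw [smul_smul, inv_mul_cancel₀ hp.ne', one_smul]
    rw [h12, ← h11, ← integral_smul]
    refine integral_congr_ae (Eventually.of_forall fun t => ?_)
    have h13 : 2 * Real.pi * ((2 * Real.pi)⁻¹ * t) * s = t * s := by
      field_simp
    simp only [ψ, h13, Complex.real_smul]
    push_cast
    ring

/-! ### Characteristic functions of Rademacher sums. -/

variable {Ω : Type*} [MeasurableSpace Ω]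

theorem IsRademacher.ae_eq_or {μ : Measure Ω} [IsProbabilityMeasure μ] {Y : Ω → ℝ}
    (hY : IsRademacher Y μ) : ∀ᵐ ω ∂μ, Y ω = 1 ∨ Y ω = -1 := by
  have hm1 : MeasurableSet {ω | Y ω = 1} := hY.measurable (measurableSet_singleton 1)
  have hm2 : MeasurableSet {ω | Y ω = -1} := hY.measurable (measurableSet_singleton (-1))
  have hd : Disjoint {ω | Y ω = 1} {ω | Y ω = -1} := by
    rw [Set.disjoint_left]
    intro ω h1 h2
    simp only [Set.mem_ofPred_eq] at h1 h2
    linarith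
  have h : μ ({ω | Y ω = 1} ∪ {ω | Y ω = -1}) = 1 := by
    rw [measure_union hd hm2, hY.prob_one, hY.prob_neg_one]
    exact ENNReal.add_halves 1
  exact (prob_compl_eq_zero_iff (hm1.union hm2)).2 h

theorem IsRademacher.integral_exp {μ : Measure Ω} [IsProbabilityMeasure μ] {Y : Ω → ℝ}
    (hY : IsRademacher Y μ) (u : ℝ) :
    ∫ ω, Complex.exp (u * Y ω * Complex.I) ∂μ = Real.cos u := by
  have hm1 : MeasurableSet {ω | Y ω = 1} := hY.measurable (measurableSet_singleton 1)
  have hm2 : MeasurableSet {ω | Y ω = -1} := hY.measurable (measurableSet_singleton (-1))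
  have h : (fun ω => Complex.exp (u * Y ω * Complex.I)) =ᵐ[μ]
      fun ω => ({ω | Y ω = 1}.indicator (fun _ => Complex.exp (u * Complex.I)) ω) +
        ({ω | Y ω = -1}.indicator (fun _ => Complex.exp (-u * Complex.I)) ω) := by
    filter_upwards [hY.ae_eq_or] with ω hω
    rcases hω with h | h
    · have : (1 : ℝ) ≠ -1 := by norm_num
      simp [h, Set.indicator, this]
    · have : (-1 : ℝ) ≠ 1 := by norm_num
      simp [h, Set.indicator, this]
  rw [integral_congr_ae h, integral_add ((integrable_const _).indicator hm1)
    ((integrable_const _).indicator hm2), integral_indicator_const _ hm1,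
    integral_indicator_const _ hm2, measureReal_def, measureReal_def, hY.prob_one,
    hY.prob_neg_one, Complex.ofReal_cos, Complex.cos]
  simp
  ring

/-- The increment `∑_{m ≤ k < n} b k * Y k` of a weighted random sum. -/
def increment {Ω : Type*} (b : ℕ → ℝ) (Y : ℕ → Ω → ℝ) (m n : ℕ) (ω : Ω) : ℝ :=
  ∑ k ∈ Finset.Ico m n, b k * Y k ω

theorem measurable_increment {μ : Measure Ω} {Y : ℕ → Ω → ℝ}
    (hY : ∀ k, IsRademacher (Y k) μ) (b : ℕ → ℝ) (m n : ℕ) :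
    Measurable (increment b Y m n) := by
  unfold increment
  exact Finset.measurable_sum _ fun k _ => (hY k).measurable.const_mul _

section

variable {μ : Measure Ω} [IsProbabilityMeasure μ] {Y : ℕ → Ω → ℝ} {b : ℕ → ℝ}

theorem integral_exp_increment (hY : ∀ k, IsRademacher (Y k) μ) (hi : iIndepFun Y μ)
    (b : ℕ → ℝ) (m n : ℕ) (t : ℝ) :
    ∫ ω, Complex.exp (t * increment b Y m n ω * Complex.I) ∂μ =
      ((∏ k ∈ Finset.Ico m n, Real.cos (t * b k) : ℝ) : ℂ) := by
  have hi' : iIndepFun (fun k : Finset.Ico m n => Y k) μ :=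
    hi.precomp Subtype.val_injective
  have h := hi'.integral_fun_prod_comp
    (f := fun (k : Finset.Ico m n) (y : ℝ) => Complex.exp (((t * b k : ℝ) : ℂ) * y * Complex.I))
    (fun k => (hY k).measurable.aemeasurable)
    (fun k => Continuous.aestronglyMeasurable (by fun_prop))
  simp only [(hY _).integral_exp] at h
  rw [← Finset.prod_coe_sort (Finset.Ico m n), Complex.ofReal_prod]
  rw [← h]
  refine integral_congr_ae (Eventually.of_forall fun ω => ?_)
  simp only
  rw [← Complex.exp_sum]
  congr 1
  rw [increment, ← Finset.sum_coe_sort]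
  push_cast
  rw [Finset.mul_sum, Finset.sum_mul]
  exact Finset.sum_congr rfl fun k _ => by ring

theorem IsFourierBump.integrable_comp {C : ℝ} {φ : ℝ → ℝ} {ψ : ℝ → ℂ} (h : IsFourierBump C φ ψ)
    {f : Ω → ℝ} (hf : Measurable f) : Integrable (fun ω => φ (f ω)) μ :=
  Integrable.of_bound (h.continuous.measurable.comp hf).aestronglyMeasurable 1
    (Eventually.of_forall fun ω => by
      rw [Real.norm_eq_abs, abs_of_nonneg (h.nonneg _)]; exact h.le_one _)

/-- Insert the inversion formula and apply Fubini, the integrand having norm `‖ψ t‖`. All later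
estimates then concern the product of cosines. -/
theorem IsFourierBump.integral_increment {C : ℝ} {φ : ℝ → ℝ} {ψ : ℝ → ℂ}
    (h : IsFourierBump C φ ψ) (hY : ∀ k, IsRademacher (Y k) μ) (hi : iIndepFun Y μ)
    (b : ℕ → ℝ) (m n : ℕ) (y : ℝ) :
    ((∫ ω, φ (y + increment b Y m n ω) ∂μ : ℝ) : ℂ) =
      ∫ t, ψ t * Complex.exp (t * y * Complex.I) *
        ((∏ k ∈ Finset.Ico m n, Real.cos (t * b k) : ℝ) : ℂ) := by
  have hm := measurable_increment hY b m n
  rw [← integral_complex_ofReal]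
  simp only [h.inversion]
  rw [integral_integral_swap]
  · refine integral_congr_ae (Eventually.of_forall fun t => ?_)
    simp only
    rw [← integral_exp_increment hY hi, ← integral_const_mul]
    refine integral_congr_ae (Eventually.of_forall fun ω => ?_)
    simp only
    rw [mul_assoc (ψ t) (Complex.exp _), ← Complex.exp_add]
    congr 2
    push_cast
    ring
  · have h1 : Integrable (fun p : Ω × ℝ => ψ p.2) (μ.prod volume) := h.integrable.comp_snd μ
    refine h1.mono ?_ (Eventually.of_forall fun p => ?_)
    · refine Measurable.aestronglyMeasurable ?_
      have := h.continuous_fourier.measurable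
      have h2 : Measurable fun p : Ω × ℝ => increment b Y m n p.1 := hm.comp measurable_fst
      simp only [Function.uncurry_def]
      fun_prop
    · simp only [Function.uncurry, norm_mul]
      rw [show ((p.2 : ℂ) * ((y + increment b Y m n p.1 : ℝ) : ℂ) * Complex.I) =
        ((p.2 * (y + increment b Y m n p.1) : ℝ) : ℂ) * Complex.I by push_cast; ring,
        Complex.norm_exp_ofReal_mul_I, mul_one]

end

/-! ### The Littlewood-Offord bound, and independence of increments. -/

/-- The induction step reduces to `(2n + 1)(2n + 3) ≤ 4(n + 1)²`. -/
theorem centralBinom_sq_mul_le (n : ℕ) : (2 * n + 1) * n.centralBinom ^ 2 ≤ 16 ^ n := by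
  induction n with
  | zero => simp
  | succ n ih =>
    have h := Nat.succ_mul_centralBinom_succ n
    have h1 : (n + 1) ^ 2 * ((2 * (n + 1) + 1) * (n + 1).centralBinom ^ 2) ≤
        (n + 1) ^ 2 * 16 ^ (n + 1) := by
      calc (n + 1) ^ 2 * ((2 * (n + 1) + 1) * (n + 1).centralBinom ^ 2)
          = (2 * n + 3) * ((n + 1) * (n + 1).centralBinom) ^ 2 := by ring
        _ = (4 * ((2 * n + 3) * (2 * n + 1))) * ((2 * n + 1) * n.centralBinom ^ 2) := by
          rw [h]; ring
        _ ≤ (4 * (4 * (n + 1) ^ 2)) * 16 ^ n :=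
          Nat.mul_le_mul (by nlinarith) ih
        _ = (n + 1) ^ 2 * 16 ^ (n + 1) := by ring
    exact Nat.le_of_mul_le_mul_left h1 (by positivity)

theorem choose_half_sq_mul_le (j : ℕ) : j * (j.choose (j / 2)) ^ 2 ≤ 4 ^ j := by
  obtain ⟨n, rfl | rfl⟩ := Nat.even_or_odd' j
  · have h := centralBinom_sq_mul_le n
    rw [Nat.centralBinom] at h
    rw [Nat.mul_div_cancel_left n two_pos, pow_mul]
    norm_num
    nlinarith [sq_nonneg ((2 * n).choose n)]
  · have h := centralBinom_sq_mul_le (n + 1)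
    have h1 : (n + 1).centralBinom = 2 * (2 * n + 1).choose n := by
      rw [Nat.centralBinom, show 2 * (n + 1) = 2 * n + 1 + 1 by ring, Nat.choose_succ_succ,
        ← Nat.choose_symm_half n]
      ring
    rw [h1] at h
    have h2 : (2 * n + 1) / 2 = n := by omega
    have h3 : 4 ^ (2 * n + 1) * 4 = 16 ^ (n + 1) := by
      rw [← pow_succ, show 2 * n + 1 + 1 = 2 * (n + 1) by ring, pow_mul]
      norm_num
    rw [h2]
    nlinarith [sq_nonneg ((2 * n + 1).choose n)]

theorem choose_half_div_le {j : ℕ} (hj : 0 < j) :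
    (j.choose (j / 2) : ℝ) / 2 ^ j ≤ 1 / √j := by
  have h : (j : ℝ) * ((j.choose (j / 2) : ℝ)) ^ 2 ≤ 4 ^ j := by
    exact_mod_cast choose_half_sq_mul_le j
  have hj' : (0 : ℝ) < √j := Real.sqrt_pos.2 (by exact_mod_cast hj)
  rw [div_le_div_iff₀ (by positivity) hj', one_mul]
  refine le_of_sq_le_sq ?_ (by positivity)
  rw [mul_pow, Real.sq_sqrt (by positivity), ← pow_mul, mul_comm j 2, pow_mul]
  norm_num
  linarith

/-- The sign pattern that is `1` on `A` and `-1` elsewhere. -/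
def signOf {ι : Type*} (A : Finset ι) [DecidableEq ι] (i : ι) : ℝ := if i ∈ A then 1 else -1

/-- Enlarging `A` strictly raises the sum by more than `2 * C`, the length of the target interval,
so the admissible sets form an antichain and Sperner's theorem applies. -/
theorem card_signOf_le {ι : Type*} [Fintype ι] [DecidableEq ι] (v : ι → ℝ) {C : ℝ}
    (hv : ∀ i, C < v i) (hC : 0 ≤ C) (y : ℝ) :
    (Finset.univ.filter fun A : Finset ι => |y + ∑ i, v i * signOf A i| ≤ C).card ≤
      (Fintype.card ι).choose (Fintype.card ι / 2) := by
  refine IsAntichain.sperner ?_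
  intro A hA B hB hAB hsub
  simp only [Finset.coe_filter, Finset.mem_univ, true_and, Set.mem_ofPred_eq] at hA hB
  obtain ⟨i, hiB, hiA⟩ : ∃ i ∈ B, i ∉ A := by
    by_contra! h
    exact hAB (Finset.Subset.antisymm hsub h)
  have h1 : ∑ j, v j * signOf A j + 2 * v i ≤ ∑ j, v j * signOf B j := by
    have h2 : ∑ j, (if j = i then 2 * v i else 0) ≤ ∑ j, (v j * signOf B j - v j * signOf A j) := by
      refine Finset.sum_le_sum fun j _ => ?_
      have := hv j
      unfold signOf
      by_cases hji : j = i
      · subst hji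
        simp [hiA, hiB]; linarith
      · by_cases hjA : j ∈ A
        · simp [hji, hjA, hsub hjA]
        · by_cases hjB : j ∈ B
          · simp [hji, hjA, hjB]; linarith
          · simp [hji, hjA, hjB]
    rw [Finset.sum_sub_distrib] at h2
    simp at h2
    linarith
  have := hv i
  rw [abs_le] at hA hB
  linarith

theorem measure_signOf {ι : Type*} [Fintype ι] [DecidableEq ι] {μ : Measure Ω}
    {Z : ι → Ω → ℝ}
    (hZ : ∀ i, IsRademacher (Z i) μ) (hi : iIndepFun Z μ) (A : Finset ι) :
    μ {ω | ∀ i, Z i ω = signOf A i} = (1 / 2) ^ Fintype.card ι := by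
  have h := hi.measure_inter_preimage_eq_mul Finset.univ
    (sets := fun i => {signOf A i}) (fun i _ => measurableSet_singleton _)
  have h1 : {ω | ∀ i, Z i ω = signOf A i} = ⋂ i ∈ Finset.univ, Z i ⁻¹' {signOf A i} := by
    ext ω; simp
  rw [h1, h, Finset.prod_congr rfl (g := fun _ => (1 / 2 : ENNReal))]
  · simp
  · intro i _
    unfold signOf
    split_ifs
    · exact (hZ i).prob_one
    · exact (hZ i).prob_neg_one

theorem increment_add {Ω : Type*} (b : ℕ → ℝ) (Y : ℕ → Ω → ℝ) {l m n : ℕ} (h1 : l ≤ m) (h2 : m ≤ n)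
    (ω : Ω) :
    increment b Y l m ω + increment b Y m n ω = increment b Y l n ω :=
  Finset.sum_Ico_consecutive _ h1 h2

theorem indepFun_increment {μ : Measure Ω} {Y : ℕ → Ω → ℝ}
    (hY : ∀ k, IsRademacher (Y k) μ) (hi : iIndepFun Y μ)
    (b : ℕ → ℝ) (l m n : ℕ) : IndepFun (increment b Y l m) (increment b Y m n) μ := by
  have h := hi.indepFun_finset (Finset.Ico l m) (Finset.Ico m n)
    (Finset.Ico_disjoint_Ico_consecutive l m n) (fun k => (hY k).measurable)
  have h1 := h.comp (φ := fun u : Finset.Ico l m → ℝ => ∑ k : Finset.Ico l m, b k * u k)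
    (ψ := fun u : Finset.Ico m n → ℝ => ∑ k : Finset.Ico m n, b k * u k)
    (by fun_prop) (by fun_prop)
  convert h1 using 1 <;>
  · ext ω
    simp only [increment, Function.comp]
    rw [← Finset.sum_coe_sort]

section

variable {μ : Measure Ω} [IsProbabilityMeasure μ] {Y : ℕ → Ω → ℝ} {b : ℕ → ℝ}

/-- The Littlewood-Offord bound, in the form due to Erdős. -/
theorem measureReal_abs_sum_le {ι : Type*} [Fintype ι] {Z : ι → Ω → ℝ}
    (hZ : ∀ i, IsRademacher (Z i) μ) (hi : iIndepFun Z μ) (hcard : 0 < Fintype.card ι)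
    (v : ι → ℝ) {C : ℝ} (hv : ∀ i, C < v i) (hC : 0 ≤ C) (y : ℝ) :
    μ.real {ω | |y + ∑ i, v i * Z i ω| ≤ C} ≤ 1 / √(Fintype.card ι) := by
  classical
  set 𝒜 := Finset.univ.filter fun A : Finset ι => |y + ∑ i, v i * signOf A i| ≤ C
  have hae : ∀ᵐ ω ∂μ, ∀ i, Z i ω = 1 ∨ Z i ω = -1 := ae_all_iff.2 fun i => (hZ i).ae_eq_or
  have h1 : μ {ω | |y + ∑ i, v i * Z i ω| ≤ C} ≤
      μ (⋃ A ∈ 𝒜, {ω | ∀ i, Z i ω = signOf A i}) := by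
    refine measure_mono_ae ?_
    filter_upwards [hae] with ω hω hmem
    have h2 : ∀ i, Z i ω = signOf (Finset.univ.filter fun i => Z i ω = 1) i := by
      intro i
      unfold signOf
      rcases hω i with h | h
      · simp [h]
      · have : (-1 : ℝ) ≠ 1 := by norm_num
        simp [h, this]
    have hmem' : |y + ∑ i, v i * Z i ω| ≤ C := hmem
    have : ω ∈ ⋃ A ∈ 𝒜, {ω | ∀ i, Z i ω = signOf A i} := by
      simp only [Set.mem_iUnion]
      refine ⟨_, ?_, h2⟩
      simp only [𝒜, Finset.mem_filter, Finset.mem_univ, true_and]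
      simpa only [← h2] using hmem'
    exact this
  have h3 : μ (⋃ A ∈ 𝒜, {ω | ∀ i, Z i ω = signOf A i}) ≤
      (𝒜.card : ENNReal) * (1 / 2) ^ Fintype.card ι := by
    refine (measure_biUnion_finset_le _ _).trans ?_
    simp [measure_signOf hZ hi]
  have h4 : μ.real {ω | |y + ∑ i, v i * Z i ω| ≤ C} ≤ (𝒜.card : ℝ) * (1 / 2) ^ Fintype.card ι := by
    have h5 := ENNReal.toReal_mono (by finiteness) (h1.trans h3)
    simpa [measureReal_def] using h5
  refine h4.trans ?_
  refine le_trans ?_ (choose_half_div_le hcard)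
  rw [one_div, inv_pow, ← div_eq_mul_inv]
  gcongr
  exact card_signOf_le v hv hC y

theorem measureReal_abs_increment_le (hY : ∀ k, IsRademacher (Y k) μ) (hi : iIndepFun Y μ)
    {C : ℝ} (hC : 0 ≤ C) {m n : ℕ} (hmn : m < n) (hb : ∀ k, m ≤ k → C < b k) (y : ℝ) :
    μ.real {ω | |y + increment b Y m n ω| ≤ C} ≤ 1 / √(n - m : ℕ) := by
  have h := measureReal_abs_sum_le (μ := μ) (Z := fun k : Finset.Ico m n => Y k)
    (fun k => hY k) (hi.precomp Subtype.val_injective) (by simpa using hmn)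
    (fun k => b k) (fun k => hb k (Finset.mem_Ico.1 k.2).1) hC y
  simp only [Fintype.card_coe, Nat.card_Ico] at h
  convert h using 5 with ω
  rw [increment, ← Finset.sum_coe_sort]

theorem IsFourierBump.integral_le_measureReal {C : ℝ} {φ : ℝ → ℝ} {ψ : ℝ → ℂ}
    (h : IsFourierBump C φ ψ) {f : Ω → ℝ} (hf : Measurable f) :
    ∫ ω, φ (f ω) ∂μ ≤ μ.real {ω | |f ω| ≤ C} := by
  have hm : MeasurableSet {ω | |f ω| ≤ C} := measurableSet_le hf.abs measurable_const
  rw [← integral_indicator_one hm]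
  refine integral_mono (h.integrable_comp hf) ((integrable_const 1).indicator hm) fun ω => ?_
  by_cases hω : |f ω| ≤ C
  · simpa [Set.indicator, hω] using h.le_one _
  · have : φ (f ω) = 0 := by
      by_contra h0
      exact hω (h.abs_le_of_ne_zero _ h0)
    simp [Set.indicator, hω, this]

/-- Given `U = u`, the second factor has mean at most `q`, uniformly in the starting point `x + u`.
This serves as the Markov property in the second moment. -/
theorem IsFourierBump.integral_mul_le {C : ℝ} {φ : ℝ → ℝ} {ψ : ℝ → ℂ} (h : IsFourierBump C φ ψ)
    {U V : Ω → ℝ} (hU : Measurable U) (hV : Measurable V) (hi : IndepFun U V μ) {q : ℝ}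
    (hq : ∀ y, ∫ ω, φ (y + V ω) ∂μ ≤ q) (x : ℝ) :
    ∫ ω, φ (x + U ω) * φ (x + (U ω + V ω)) ∂μ ≤ q * ∫ ω, φ (x + U ω) ∂μ := by
  have hc := h.continuous
  have hmap := (indepFun_iff_map_prod_eq_prod_map_map hU.aemeasurable hV.aemeasurable).1 hi
  have : IsProbabilityMeasure (μ.map U) := Measure.isProbabilityMeasure_map hU.aemeasurable
  have : IsProbabilityMeasure (μ.map V) := Measure.isProbabilityMeasure_map hV.aemeasurable
  set F : ℝ × ℝ → ℝ := fun p => φ (x + p.1) * φ (x + (p.1 + p.2))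
  have hF : Continuous F := by fun_prop
  have hFi : Integrable F ((μ.map U).prod (μ.map V)) := by
    refine Integrable.of_bound hF.aestronglyMeasurable 1 (Eventually.of_forall fun p => ?_)
    simp only [F]
    rw [Real.norm_eq_abs, abs_of_nonneg (mul_nonneg (h.nonneg _) (h.nonneg _))]
    exact mul_le_one₀ (h.le_one _) (h.nonneg _) (h.le_one _)
  have e1 : ∫ ω, φ (x + U ω) * φ (x + (U ω + V ω)) ∂μ = ∫ p, F p ∂((μ.map U).prod (μ.map V)) := by
    rw [← hmap, integral_map (hU.prodMk hV).aemeasurable hF.aestronglyMeasurable]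
  have e2 : ∫ ω, φ (x + U ω) ∂μ = ∫ u, φ (x + u) ∂(μ.map U) := by
    rw [integral_map hU.aemeasurable]
    exact Continuous.aestronglyMeasurable (by fun_prop)
  rw [e1, e2, integral_prod _ hFi, ← integral_const_mul]
  refine integral_mono hFi.integral_prod_left
    ((h.integrable_comp (f := fun u => x + u) (by fun_prop)).const_mul q) fun u => ?_
  simp only [F]
  rw [integral_const_mul, mul_comm q]
  refine mul_le_mul_of_nonneg_left ?_ (h.nonneg _)
  rw [integral_map hV.aemeasurable (Continuous.aestronglyMeasurable (by fun_prop))]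
  simpa [add_assoc] using hq (x + u)

end

/-! ### Comparison of powers of `N` and `log N`. -/

/-- `u` is the fourth root of `N`, and `N` is large enough for `u` to dominate powers of `log N`. -/
structure IsLargeScale (N : ℕ) (u : ℝ) : Prop where
  pos : 0 < u
  pow_eq : u ^ 4 = N
  log_le : 100000 * Real.log (4 * N) ^ 3 ≤ u
  one_le_log : 1 ≤ Real.log N

theorem eventually_isLargeScale :
    ∀ᶠ N : ℕ in atTop, IsLargeScale N ((N : ℝ) ^ (1 / 4 : ℝ)) := by
  have hu : Tendsto (fun N : ℕ => (N : ℝ) ^ (1 / 4 : ℝ)) atTop atTop :=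
    (tendsto_rpow_atTop (by norm_num)).comp tendsto_natCast_atTop_atTop
  -- The constant is `100000 * 8 ^ 3`, because `log (4N) ≤ 8 log u`.
  have h1 : ∀ᶠ u : ℝ in atTop, 51200000 * Real.log u ^ 3 ≤ u := by
    have := (Real.isLittleO_pow_log_id_atTop (n := 3)).def (c := 1 / 51200000) (by norm_num)
    filter_upwards [this, eventually_ge_atTop 1] with u h hu1
    have h2 : 0 ≤ Real.log u := Real.log_nonneg hu1
    rw [Real.norm_eq_abs, abs_of_nonneg (by positivity), id, Real.norm_eq_abs,
      abs_of_nonneg (by linarith)] at h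
    linarith
  filter_upwards [hu.eventually h1, hu.eventually (eventually_ge_atTop 4), eventually_gt_atTop 0]
    with N h2 h3 hN
  set u := (N : ℝ) ^ (1 / 4 : ℝ) with hudef
  have hN' : (0 : ℝ) < N := by exact_mod_cast hN
  have hu4 : u ^ 4 = N := by
    rw [hudef, ← Real.rpow_natCast, ← Real.rpow_mul hN'.le]
    norm_num
  have hupos : 0 < u := by linarith
  have hlog : Real.log N = 4 * Real.log u := by
    rw [← hu4, Real.log_pow]; norm_num
  have h4 : Real.log 4 ≤ Real.log u := Real.log_le_log (by norm_num) h3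
  have h5 : 1 ≤ Real.log 4 := by
    rw [Real.le_log_iff_exp_le (by norm_num)]
    linarith [Real.exp_one_lt_d9]
  have h6 : Real.log (4 * N) ≤ 8 * Real.log u := by
    rw [Real.log_mul (by norm_num) hN'.ne', hlog]
    linarith
  refine ⟨hupos, hu4, ?_, by rw [hlog]; linarith⟩
  have h7 : 0 ≤ Real.log (4 * N) := by
    rw [Real.log_mul (by norm_num) hN'.ne', hlog]; linarith
  calc 100000 * Real.log (4 * N) ^ 3 ≤ 100000 * (8 * Real.log u) ^ 3 := by gcongr
    _ = 51200000 * Real.log u ^ 3 := by ring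
    _ ≤ u := h2

namespace IsLargeScale

variable {N : ℕ} {u : ℝ}

theorem cast_pos (h : IsLargeScale N u) : (0 : ℝ) < N := by
  rw [← h.pow_eq]; have := h.pos; positivity

theorem log_le_log_four_mul (h : IsLargeScale N u) : Real.log N ≤ Real.log (4 * N) :=
  Real.log_le_log h.cast_pos (by linarith [h.cast_pos])

theorem one_le_log_four_mul (h : IsLargeScale N u) : 1 ≤ Real.log (4 * N) :=
  h.one_le_log.trans h.log_le_log_four_mul

theorem large (h : IsLargeScale N u) : 100000 ≤ u := by
  have := one_le_pow₀ h.one_le_log_four_mul (n := 3)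
  linarith [h.log_le]

theorem log_four_mul_le (h : IsLargeScale N u) : Real.log (4 * N) ≤ 3 * Real.log N := by
  have h4 : Real.log 4 ≤ 2 * Real.log N := by
    have : Real.log 4 = 2 * Real.log 2 := by
      rw [show (4 : ℝ) = 2 ^ 2 by norm_num, Real.log_pow]; norm_num
    linarith [Real.log_two_lt_d9, h.one_le_log]
  rw [Real.log_mul (by norm_num) h.cast_pos.ne']
  linarith

theorem log_mul_le (h : IsLargeScale N u) : 100000 * Real.log N ≤ u := by
  have h1 := h.one_le_log_four_mul
  have h2 : Real.log (4 * N) ≤ Real.log (4 * N) ^ 3 := le_self_pow₀ h1 (by norm_num)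
  linarith [h.log_le, h.log_le_log_four_mul]

theorem sq_log_le (h : IsLargeScale N u) : Real.log N ^ 2 ≤ u := by
  have h1 := h.one_le_log_four_mul
  have h2 : Real.log (4 * N) ^ 2 ≤ Real.log (4 * N) ^ 3 := pow_le_pow_right₀ h1 (by norm_num)
  have h3 : Real.log N ^ 2 ≤ Real.log (4 * N) ^ 2 :=
    pow_le_pow_left₀ (by linarith [h.one_le_log]) h.log_le_log_four_mul 2
  have h4 : 0 ≤ Real.log N ^ 2 := by positivity
  linarith [h.log_le]

theorem sqrt_eq (h : IsLargeScale N u) : √(N : ℝ) = u ^ 2 := by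
  rw [← h.pow_eq, show u ^ 4 = (u ^ 2) ^ 2 by ring, Real.sqrt_sq (by positivity)]

end IsLargeScale

/-! ### Decay of the product of cosines. -/

/-- Expand `sin ((θ + d) - θ)`. Two phases differing by `d` cannot both be near `πℤ` unless `d` is.
-/
theorem sin_sq_le_two_mul (θ d : ℝ) :
    Real.sin d ^ 2 ≤ 2 * (Real.sin θ ^ 2 + Real.sin (θ + d) ^ 2) := by
  have h : Real.sin d = Real.sin (θ + d) * Real.cos θ - Real.cos (θ + d) * Real.sin θ := by
    rw [← Real.sin_sub]; ring_nf
  have h1 := Real.sin_sq_add_cos_sq θ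
  have h2 := Real.sin_sq_add_cos_sq (θ + d)
  set a := Real.sin (θ + d)
  set b := Real.cos θ
  set e := Real.cos (θ + d)
  set g := Real.sin θ
  rw [h]
  nlinarith [sq_nonneg (a * b + e * g), mul_nonneg (sq_nonneg a) (sq_nonneg g)]

theorem half_le_sin {x : ℝ} (h0 : 0 ≤ x) (h1 : x ≤ 1) : x / 2 ≤ Real.sin x := by
  have := Real.mul_le_sin h0 (by linarith [Real.pi_gt_three])
  have h2 : 1 / 2 ≤ 2 / Real.pi := by
    rw [div_le_div_iff₀ (by norm_num) Real.pi_pos]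
    linarith [Real.pi_le_four]
  nlinarith

theorem abs_cos_le_exp (x : ℝ) : |Real.cos x| ≤ Real.exp (-(Real.sin x ^ 2) / 2) := by
  refine abs_le_of_sq_le_sq ?_ (Real.exp_pos _).le
  rw [← Real.exp_nat_mul, Real.cos_sq']
  have := Real.add_one_le_exp (-(Real.sin x ^ 2))
  rw [show ((2 : ℕ) : ℝ) * (-(Real.sin x ^ 2) / 2) = -(Real.sin x ^ 2) by push_cast; ring]
  linarith

theorem prod_abs_cos_le_exp {ι : Type*} (s : Finset ι) (θ : ι → ℝ) :
    ∏ k ∈ s, |Real.cos (θ k)| ≤ Real.exp (-(∑ k ∈ s, Real.sin (θ k) ^ 2) / 2) := by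
  rw [← Finset.sum_neg_distrib, Finset.sum_div, Real.exp_sum]
  exact Finset.prod_le_prod (fun _ _ => abs_nonneg _) fun k _ => abs_cos_le_exp _

/-- The step sizes `log (k + 1)`. -/
noncomputable def logStep (k : ℕ) : ℝ := Real.log (k + 1)

/-- Pair `k` with `k + h`. Their phases differ by `t log (1 + h / (k + 1))`, which lies between `t h
/ (4N)` and `1`, so its sine is at least `t h / (8N)`. There are at least `j / 2` pairs and each
index occurs in at most two; with the factor `2` of `sin_sq_le_two_mul` this gives `j / 8`. -/
theorem sum_sin_sq_ge {N n j h : ℕ} {t : ℝ} (hN : 0 < N) (hn : N ≤ n) (hnj : n + j ≤ 4 * N)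
    (hh : 2 * h ≤ j) (ht : 0 ≤ t) (hth : t * h ≤ N) :
    (j : ℝ) / 8 * (t * h / (8 * N)) ^ 2 ≤
      ∑ k ∈ Finset.Ico n (n + j), Real.sin (t * logStep k) ^ 2 := by
  have hN' : (0 : ℝ) < N := by exact_mod_cast hN
  have hpair : ∀ k ∈ Finset.Ico n (n + (j - h)), (t * h / (8 * N)) ^ 2 ≤
      2 * (Real.sin (t * logStep k) ^ 2 + Real.sin (t * logStep (k + h)) ^ 2) := by
    intro k hk
    rw [Finset.mem_Ico] at hk
    have hk1 : (N : ℝ) ≤ k + 1 := by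
      have : N ≤ k + 1 := by omega
      exact_mod_cast this
    have hk2 : (k : ℝ) + 1 + h ≤ 4 * N := by
      have : k + 1 + h ≤ 4 * N := by omega
      exact_mod_cast this
    have hkp : (0 : ℝ) < k + 1 := by positivity
    have hkh : (0 : ℝ) < k + 1 + h := by positivity
    set d := t * (Real.log (k + 1 + h) - Real.log (k + 1)) with hd
    have hsum : t * logStep (k + h) = t * logStep k + d := by
      simp only [logStep, hd]
      push_cast
      rw [show (k : ℝ) + h + 1 = k + 1 + h by ring]
      ring
    have hquot : Real.log (k + 1 + h) - Real.log (k + 1) = Real.log ((k + 1 + h) / (k + 1)) :=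
      (Real.log_div hkh.ne' hkp.ne').symm
    have hlow : t * h / (4 * N) ≤ d := by
      have h1 := Real.one_sub_inv_le_log_of_pos (div_pos hkh hkp)
      rw [inv_div, ← hquot] at h1
      have h2 : 1 - ((k : ℝ) + 1) / (k + 1 + h) = h / (k + 1 + h) := by
        field_simp; ring
      rw [h2] at h1
      calc t * h / (4 * N) ≤ t * h / (k + 1 + h) := by gcongr
        _ = t * (h / (k + 1 + h)) := by ring
        _ ≤ d := by rw [hd]; gcongr
    have hup : d ≤ 1 := by
      have h1 := Real.log_le_sub_one_of_pos (div_pos hkh hkp)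
      rw [← hquot] at h1
      have h2 : ((k : ℝ) + 1 + h) / (k + 1) - 1 = h / (k + 1) := by
        field_simp; ring
      rw [h2] at h1
      calc d ≤ t * (h / (k + 1)) := by rw [hd]; gcongr
        _ = t * h / (k + 1) := by ring
        _ ≤ N / N := by gcongr
        _ = 1 := div_self hN'.ne'
    have hd0 : 0 ≤ d := le_trans (by positivity) hlow
    have hs : t * h / (8 * N) ≤ Real.sin d := by
      have := half_le_sin hd0 hup
      have e : t * h / (8 * N) = t * h / (4 * N) / 2 := by ring
      rw [e]; linarith
    rw [hsum]
    exact (pow_le_pow_left₀ (by positivity) hs 2).trans (sin_sq_le_two_mul _ _)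
  have h1 := Finset.sum_le_sum hpair
  rw [← Finset.mul_sum, Finset.sum_add_distrib] at h1
  have h2 : ∑ k ∈ Finset.Ico n (n + (j - h)), Real.sin (t * logStep k) ^ 2 ≤
      ∑ k ∈ Finset.Ico n (n + j), Real.sin (t * logStep k) ^ 2 :=
    Finset.sum_le_sum_of_subset_of_nonneg (Finset.Ico_subset_Ico_right (by omega))
      fun _ _ _ => sq_nonneg _
  have h3 : ∑ k ∈ Finset.Ico n (n + (j - h)), Real.sin (t * logStep (k + h)) ^ 2 ≤
      ∑ k ∈ Finset.Ico n (n + j), Real.sin (t * logStep k) ^ 2 := by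
    rw [Finset.sum_Ico_add' (fun k => Real.sin (t * logStep k) ^ 2)]
    exact Finset.sum_le_sum_of_subset_of_nonneg (Finset.Ico_subset_Ico (by omega) (by omega))
      fun _ _ _ => sq_nonneg _
  simp only [Finset.sum_const, Nat.card_Ico, nsmul_eq_mul] at h1
  have h4 : (j : ℝ) / 2 ≤ ((n + (j - h) - n : ℕ) : ℝ) := by
    have : j ≤ 2 * (n + (j - h) - n) := by omega
    have : (j : ℝ) ≤ 2 * ((n + (j - h) - n : ℕ) : ℝ) := by exact_mod_cast this
    linarith
  have h5 := mul_le_mul_of_nonneg_right h4 (sq_nonneg (t * h / (8 * N)))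
  linarith

theorem prod_abs_cos_le_inv {N n j : ℕ} {u t : ℝ} (hs : IsLargeScale N u) (hn : N ≤ n)
    (hnj : n + j ≤ 4 * N) (hj : u ^ 3 ≤ j) (ht : 1 / Real.log (4 * N) ≤ t) (ht' : t ≤ N / 4) :
    ∏ k ∈ Finset.Ico n (n + j), |Real.cos (t * logStep k)| ≤ 1 / N := by
  have hN := hs.cast_pos
  have hN' : 0 < N := by exact_mod_cast hN
  have hu := hs.pos
  have hul := hs.large
  have hl := hs.one_le_log_four_mul
  have hlN := hs.log_mul_le
  have ht0 : 0 < t := lt_of_lt_of_le (by positivity) ht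
  have hu3 : u ≤ u ^ 3 := le_self_pow₀ (by linarith) (by norm_num)
  have hjbig : (100000 : ℝ) ≤ j := by linarith
  have hjp : (0 : ℝ) < j := by linarith
  -- The shift `h` is chosen to make the phase difference as large as is allowed, up to a constant:
  -- `j / 2` if `t * j ≤ N`, and about `N / (2t)` otherwise.
  suffices hsum : 2 * Real.log N ≤ ∑ k ∈ Finset.Ico n (n + j), Real.sin (t * logStep k) ^ 2 by
    refine (prod_abs_cos_le_exp _ _).trans ?_
    rw [one_div, ← Real.exp_log hN, ← Real.exp_neg]
    exact Real.exp_le_exp.2 (by linarith)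
  by_cases hc : t * j ≤ N
  · have hh : (j : ℝ) / 3 ≤ ((j / 2 : ℕ) : ℝ) := by
      have h1 : 100000 ≤ j := by exact_mod_cast hjbig
      have : j ≤ 3 * (j / 2) := by omega
      have : (j : ℝ) ≤ 3 * ((j / 2 : ℕ) : ℝ) := by exact_mod_cast this
      linarith
    have hh2 : ((j / 2 : ℕ) : ℝ) ≤ j := by exact_mod_cast Nat.div_le_self j 2
    have hmain := sum_sin_sq_ge (h := j / 2) hN' hn hnj (by omega) ht0.le
      (le_trans (by gcongr) hc)
    refine le_trans ?_ hmain
    have h1 : (j : ℝ) / 8 * (t * (j / 3) / (8 * N)) ^ 2 ≤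
        (j : ℝ) / 8 * (t * ((j / 2 : ℕ) : ℝ) / (8 * N)) ^ 2 := by gcongr
    refine le_trans ?_ h1
    -- Up to logarithms `j ^ 3 * t ^ 2` is at least `u ^ 9`, against `N ^ 2 = u ^ 8`; the spare
    -- factor `u` absorbs the logarithms.
    have h2 : (u ^ 3) ^ 3 ≤ (j : ℝ) ^ 3 := by gcongr
    have h3 : (1 / Real.log (4 * N)) ^ 2 ≤ t ^ 2 := by gcongr
    have h4 : (u ^ 3) ^ 3 * (1 / Real.log (4 * N)) ^ 2 ≤ (j : ℝ) ^ 3 * t ^ 2 :=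
      mul_le_mul h2 h3 (by positivity) (by positivity)
    have e1 : (j : ℝ) / 8 * (t * (j / 3) / (8 * N)) ^ 2 = (j : ℝ) ^ 3 * t ^ 2 / (4608 * N ^ 2) := by
      field_simp; norm_num
    rw [e1, le_div_iff₀ (by positivity)]
    refine le_trans ?_ h4
    rw [div_pow, one_pow, mul_one_div, le_div_iff₀ (by positivity)]
    have h5 : Real.log N * Real.log (4 * N) ^ 2 ≤ Real.log (4 * N) ^ 3 := by
      rw [pow_succ' (Real.log (4 * N)) 2]
      exact mul_le_mul_of_nonneg_right hs.log_le_log_four_mul (by positivity)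
    have h6 : 9216 * (Real.log N * Real.log (4 * N) ^ 2) ≤ u := by
      have : 0 ≤ Real.log (4 * N) ^ 3 := by positivity
      linarith [hs.log_le]
    calc 2 * Real.log N * (4608 * (N : ℝ) ^ 2) * Real.log (4 * N) ^ 2
        = 9216 * (Real.log N * Real.log (4 * N) ^ 2) * (N : ℝ) ^ 2 := by ring
      _ = 9216 * (Real.log N * Real.log (4 * N) ^ 2) * (u ^ 4) ^ 2 := by rw [hs.pow_eq]
      _ = 9216 * (Real.log N * Real.log (4 * N) ^ 2) * u ^ 8 := by ring
      _ ≤ u * u ^ 8 := by gcongr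
      _ = (u ^ 3) ^ 3 := by ring
  · push Not at hc
    set h := ⌊(N : ℝ) / (2 * t)⌋₊ with hh
    have h1 : (h : ℝ) ≤ N / (2 * t) := Nat.floor_le (by positivity)
    have h2 : (N : ℝ) / (2 * t) < h + 1 := Nat.lt_floor_add_one _
    rw [le_div_iff₀ (by positivity)] at h1
    rw [div_lt_iff₀ (by positivity)] at h2
    have h3 : 2 * h ≤ j := by
      have h4 : t * (2 * h) ≤ t * j := by linarith
      have : (2 * h : ℝ) ≤ j := le_of_mul_le_mul_left h4 ht0
      exact_mod_cast this
    have hmain := sum_sin_sq_ge (h := h) hN' hn hnj h3 ht0.le (by nlinarith)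
    refine le_trans ?_ hmain
    -- Since `t ≤ N / 4`, rounding down costs at most half of `N / (2t)`.
    have h5 : (1 : ℝ) / 32 ≤ t * h / (8 * N) := by
      rw [div_le_div_iff₀ (by norm_num) (by positivity)]
      linarith
    calc 2 * Real.log N ≤ (j : ℝ) / 8 * (1 / 32) ^ 2 := by nlinarith
      _ ≤ _ := by gcongr

theorem prod_abs_cos_abs (s : Finset ℕ) (t : ℝ) :
    ∏ k ∈ s, |Real.cos (|t| * logStep k)| = ∏ k ∈ s, |Real.cos (t * logStep k)| := by
  refine Finset.prod_congr rfl fun k _ => ?_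
  rcases abs_choice t with h | h <;> rw [h]
  rw [neg_mul, Real.cos_neg]

theorem prod_abs_cos_nonneg (s : Finset ℕ) (t : ℝ) :
    0 ≤ ∏ k ∈ s, |Real.cos (t * logStep k)| := Finset.prod_nonneg fun _ _ => abs_nonneg _

theorem prod_abs_cos_le_one (s : Finset ℕ) (t : ℝ) :
    ∏ k ∈ s, |Real.cos (t * logStep k)| ≤ 1 :=
  Finset.prod_le_one (fun _ _ => abs_nonneg _) fun _ _ => Real.abs_cos_le_one _

/-- Once `|t| > N / 4`, the trivial bound `1` on the product is below `4 * |t| / N`. With `a = ‖ψ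
t‖` the first moment of `ψ` pays for these frequencies. -/
theorem mul_prod_abs_cos_le {N n j : ℕ} {u t : ℝ} (hs : IsLargeScale N u) (hn : N ≤ n)
    (hnj : n + j ≤ 4 * N) (hj : u ^ 3 ≤ j) (ht : 1 / Real.log (4 * N) ≤ |t|) {a : ℝ} (ha : 0 ≤ a) :
    a * ∏ k ∈ Finset.Ico n (n + j), |Real.cos (t * logStep k)| ≤ (a + 4 * (|t| * a)) / N := by
  have hN := hs.cast_pos
  by_cases h : |t| ≤ N / 4
  · have h1 := prod_abs_cos_le_inv hs hn hnj hj ht h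
    rw [prod_abs_cos_abs] at h1
    calc a * ∏ k ∈ Finset.Ico n (n + j), |Real.cos (t * logStep k)| ≤ a * (1 / N) := by gcongr
      _ = a / N := by ring
      _ ≤ (a + 4 * (|t| * a)) / N := by gcongr; linarith [mul_nonneg (abs_nonneg t) ha]
  · push Not at h
    have h1 := prod_abs_cos_le_one (Finset.Ico n (n + j)) t
    refine (mul_le_of_le_one_right ha h1).trans ?_
    rw [le_div_iff₀ hN]
    nlinarith

/-- Here every phase is at most `1` in absolute value, so its sine is at least half of it. -/
theorem prod_abs_cos_le_gaussian {N n j : ℕ} {u t : ℝ} (hs : IsLargeScale N u) (hn : N ≤ n)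
    (hnj : n + j ≤ 4 * N) (ht : |t| ≤ 1 / Real.log (4 * N)) :
    ∏ k ∈ Finset.Ico n (n + j), |Real.cos (t * logStep k)| ≤
      Real.exp (-(j * Real.log N ^ 2 / 8) * t ^ 2) := by
  have hN := hs.cast_pos
  have hl := hs.one_le_log_four_mul
  have hlN := hs.one_le_log
  rw [← prod_abs_cos_abs]
  refine (prod_abs_cos_le_exp _ _).trans (Real.exp_le_exp.2 ?_)
  have h1 : ∀ k ∈ Finset.Ico n (n + j), (|t| * Real.log N / 2) ^ 2 ≤
      Real.sin (|t| * logStep k) ^ 2 := by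
    intro k hk
    rw [Finset.mem_Ico] at hk
    have hk1 : (N : ℝ) ≤ k + 1 := by
      have : N ≤ k + 1 := by omega
      exact_mod_cast this
    have hk2 : (k : ℝ) + 1 ≤ 4 * N := by
      have : k + 1 ≤ 4 * N := by omega
      exact_mod_cast this
    have h2 : Real.log N ≤ logStep k := Real.log_le_log hN hk1
    have h3 : logStep k ≤ Real.log (4 * N) := Real.log_le_log (by positivity) hk2
    have h4 : |t| * logStep k ≤ 1 := by
      calc |t| * logStep k ≤ 1 / Real.log (4 * N) * Real.log (4 * N) := by
            gcongr
            linarith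
        _ = 1 := by field_simp
    have h5 := half_le_sin (mul_nonneg (abs_nonneg t) (by linarith)) h4
    refine pow_le_pow_left₀ (by positivity) (le_trans ?_ h5) 2
    gcongr
  have h6 := Finset.sum_le_sum h1
  simp only [Finset.sum_const, Nat.card_Ico, nsmul_eq_mul] at h6
  rw [Nat.add_sub_cancel_left, div_pow, mul_pow, sq_abs] at h6
  linarith

theorem IsFourierBump.integrable_weight {C : ℝ} {φ : ℝ → ℝ} {ψ : ℝ → ℂ}
    (h : IsFourierBump C φ ψ) : Integrable fun t => ‖ψ t‖ + 4 * (|t| * ‖ψ t‖) :=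
  h.integrable.norm.add (h.integrable_mul.const_mul 4)

theorem norm_mul_exp_mul_prod (z : ℂ) (y t : ℝ) (s : Finset ℕ) :
    ‖z * Complex.exp (t * y * Complex.I) * ((∏ k ∈ s, Real.cos (t * logStep k) : ℝ) : ℂ)‖ =
      ‖z‖ * ∏ k ∈ s, |Real.cos (t * logStep k)| := by
  rw [norm_mul, norm_mul, ← Complex.ofReal_mul, Complex.norm_exp_ofReal_mul_I, mul_one,
    Complex.norm_real, Real.norm_eq_abs, Finset.abs_prod]

theorem IsLargeScale.sqrt_mul_log_le {N j : ℕ} {u : ℝ} (hs : IsLargeScale N u) (hj : j ≤ 4 * N) :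
    √(j : ℝ) * Real.log N ≤ N := by
  have h1 : √(j : ℝ) ≤ 2 * u ^ 2 := by
    rw [← hs.sqrt_eq]
    have h2 : (j : ℝ) ≤ 4 * N := by exact_mod_cast hj
    calc √(j : ℝ) ≤ √(4 * N) := Real.sqrt_le_sqrt h2
      _ = 2 * √(N : ℝ) := by
        rw [Real.sqrt_mul (by norm_num), show (4 : ℝ) = 2 ^ 2 by norm_num,
          Real.sqrt_sq (by norm_num)]
  have h3 := hs.log_mul_le
  have h4 := hs.large
  calc √(j : ℝ) * Real.log N ≤ (2 * u ^ 2) * (u / 2) := by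
        have := hs.one_le_log
        gcongr
        linarith
    _ = u ^ 3 * 1 := by ring
    _ ≤ u ^ 3 * u := by have := hs.pos; gcongr; linarith
    _ = N := by rw [← hs.pow_eq]; ring

/-! ### Upper bounds for the expected number of visits. -/

section

variable {μ : Measure Ω} [IsProbabilityMeasure μ] {Y : ℕ → Ω → ℝ}

theorem IsFourierBump.exists_integral_increment_le {C : ℝ} {φ : ℝ → ℝ} {ψ : ℝ → ℂ}
    (h : IsFourierBump C φ ψ) (hY : ∀ k, IsRademacher (Y k) μ) (hi : iIndepFun Y μ) :
    ∃ K : ℝ, 0 < K ∧ ∀ (N n j : ℕ) (u y : ℝ), IsLargeScale N u → N ≤ n → n + j ≤ 4 * N →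
      u ^ 3 ≤ j → ∫ ω, φ (y + increment logStep Y n (n + j) ω) ∂μ ≤ K / (√j * Real.log N) := by
  obtain ⟨B, hB0, hB⟩ := h.bounded
  set I := ∫ t, (‖ψ t‖ + 4 * (|t| * ‖ψ t‖)) with hI
  have hI0 : 0 ≤ I := integral_nonneg fun t => by positivity
  -- The Gaussian integral yields `√(8π) ≤ 6`; the other frequencies yield `I / N`, absorbed by
  -- `IsLargeScale.sqrt_mul_log_le`.
  refine ⟨6 * B + I, by positivity, fun N n j u y hs hn hnj hj => ?_⟩
  have hN := hs.cast_pos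
  have hl := hs.one_le_log
  have hu := hs.pos
  have hjp : (0 : ℝ) < j := lt_of_lt_of_le (by positivity) hj
  have hb : 0 < (j * Real.log N ^ 2 / 8 : ℝ) := by positivity
  have hg1 : Integrable fun t : ℝ => B * Real.exp (-(j * Real.log N ^ 2 / 8) * t ^ 2) :=
    (integrable_exp_neg_mul_sq hb).const_mul B
  have hg2 : Integrable fun t => (‖ψ t‖ + 4 * (|t| * ‖ψ t‖)) / N := h.integrable_weight.div_const _
  have hbound : ∀ t, ‖ψ t * Complex.exp (t * y * Complex.I) *
      ((∏ k ∈ Finset.Ico n (n + j), Real.cos (t * logStep k) : ℝ) : ℂ)‖ ≤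
      B * Real.exp (-(j * Real.log N ^ 2 / 8) * t ^ 2) + (‖ψ t‖ + 4 * (|t| * ‖ψ t‖)) / N := by
    intro t
    rw [norm_mul_exp_mul_prod]
    rcases le_total |t| (1 / Real.log (4 * N)) with ht | ht
    · have h1 := mul_le_mul (hB t) (prod_abs_cos_le_gaussian hs hn hnj ht)
        (prod_abs_cos_nonneg _ _) hB0.le
      have : 0 ≤ (‖ψ t‖ + 4 * (|t| * ‖ψ t‖)) / N := by positivity
      linarith
    · have h1 := mul_prod_abs_cos_le hs hn hnj hj ht (norm_nonneg (ψ t))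
      have : 0 ≤ B * Real.exp (-(j * Real.log N ^ 2 / 8) * t ^ 2) := by positivity
      linarith
  have h2 := norm_integral_le_of_norm_le (hg1.add hg2) (Eventually.of_forall hbound)
  rw [← h.integral_increment hY hi, Complex.norm_real] at h2
  have h3 := (le_abs_self _).trans h2
  refine h3.trans ?_
  simp only [Pi.add_apply]
  rw [integral_add hg1 hg2, integral_const_mul, integral_gaussian, integral_div, ← hI, add_div]
  have hsq : (0 : ℝ) < √(j : ℝ) * Real.log N := by positivity
  refine add_le_add ?_ ?_
  · rw [mul_comm 6 B, mul_div_assoc B 6]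
    refine mul_le_mul_of_nonneg_left ?_ hB0.le
    refine Real.sqrt_le_iff.2 ⟨by positivity, ?_⟩
    rw [div_pow, mul_pow, Real.sq_sqrt hjp.le, div_div_eq_mul_div]
    gcongr
    linarith [Real.pi_le_four]
  · exact div_le_div_of_nonneg_left hI0 hsq (hs.sqrt_mul_log_le (by omega))

/-- The term at `j = 0` is zero by the convention for division, which is why `smallBallBound` treats
`j = 0` separately. -/
theorem sum_one_div_sqrt_le (M : ℕ) :
    ∑ j ∈ Finset.range (M + 1), 1 / √(j : ℝ) ≤ 2 * √(M : ℝ) := by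
  induction M with
  | zero => simp
  | succ M ih =>
    rw [Finset.sum_range_succ]
    have h1 : 0 < √((M + 1 : ℕ) : ℝ) := Real.sqrt_pos.2 (by positivity)
    have h2 : √((M + 1 : ℕ) : ℝ) ^ 2 = √(M : ℝ) ^ 2 + 1 := by
      rw [Real.sq_sqrt (by positivity), Real.sq_sqrt (by positivity)]; push_cast; ring
    have h3 : 1 / √((M + 1 : ℕ) : ℝ) ≤ 2 * √((M + 1 : ℕ) : ℝ) - 2 * √(M : ℝ) := by
      rw [div_le_iff₀ h1]
      nlinarith [sq_nonneg (√((M + 1 : ℕ) : ℝ) - √(M : ℝ))]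
    linarith

/-- A bound for the probability that an increment of length `j` around time `N` is small. -/
noncomputable def smallBallBound (N : ℕ) (u K : ℝ) (j : ℕ) : ℝ :=
  (if j = 0 then 1 else 0) + (if (j : ℝ) < u ^ 3 then 1 / √(j : ℝ) else 0) +
    K / Real.log N * (1 / √(j : ℝ))

theorem sum_smallBallBound_le {N M : ℕ} {u K : ℝ} (hs : IsLargeScale N u) (hK : 0 < K)
    (hM : M ≤ 4 * N) :
    ∑ j ∈ Finset.range M, smallBallBound N u K j ≤ (5 + 4 * K) * (u ^ 2 / Real.log N) := by
  have hl := hs.one_le_log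
  have hu := hs.pos
  have hul := hs.large
  have hlog0 : 0 < Real.log N := by linarith
  have hnn : ∀ j : ℕ, 0 ≤ 1 / √(j : ℝ) := fun j => by positivity
  unfold smallBallBound
  rw [Finset.sum_add_distrib, Finset.sum_add_distrib, ← Finset.mul_sum]
  have h1 : ∑ j ∈ Finset.range M, (if j = 0 then (1 : ℝ) else 0) ≤ u ^ 2 / Real.log N := by
    calc ∑ j ∈ Finset.range M, (if j = 0 then (1 : ℝ) else 0) ≤ 1 := by
          rw [Finset.sum_ite_eq']; split_ifs <;> norm_num
      _ ≤ u ^ 2 / Real.log N := by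
        rw [le_div_iff₀ hlog0]
        nlinarith [hs.log_mul_le]
  have h2 : ∑ j ∈ Finset.range M, (if (j : ℝ) < u ^ 3 then 1 / √(j : ℝ) else 0) ≤
      4 * (u ^ 2 / Real.log N) := by
    rw [← Finset.sum_filter]
    calc ∑ j ∈ (Finset.range M).filter (fun j : ℕ => (j : ℝ) < u ^ 3), 1 / √(j : ℝ)
        ≤ ∑ j ∈ Finset.range (⌈u ^ 3⌉₊ + 1), 1 / √(j : ℝ) := by
          refine Finset.sum_le_sum_of_subset_of_nonneg ?_ fun j _ _ => hnn j
          intro j hj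
          rw [Finset.mem_filter] at hj
          have := Nat.lt_ceil.2 hj.2
          exact Finset.mem_range.2 (by omega)
      _ ≤ 2 * √(⌈u ^ 3⌉₊ : ℝ) := sum_one_div_sqrt_le _
      _ ≤ 2 * (2 * (u ^ 2 / Real.log N)) := by
          refine mul_le_mul_of_nonneg_left ?_ (by norm_num)
          -- Short increments are negligible: `u ^ 3 ≤ u ^ 4 / (log N) ^ 2` because `(log N) ^ 2 ≤
          -- u`.
          refine Real.sqrt_le_iff.2 ⟨by positivity, ?_⟩
          have h3 : (⌈u ^ 3⌉₊ : ℝ) < u ^ 3 + 1 := Nat.ceil_lt_add_one (by positivity)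
          have h4 : (1 : ℝ) ≤ u ^ 3 := one_le_pow₀ (by linarith)
          rw [mul_pow, div_pow]
          have h5 : u ^ 3 ≤ (u ^ 2) ^ 2 / Real.log N ^ 2 := by
            rw [le_div_iff₀ (by positivity)]
            calc u ^ 3 * Real.log N ^ 2 ≤ u ^ 3 * u := by gcongr; exact hs.sq_log_le
              _ = (u ^ 2) ^ 2 := by ring
          linarith
      _ = 4 * (u ^ 2 / Real.log N) := by ring
  have h3 : ∑ j ∈ Finset.range M, 1 / √(j : ℝ) ≤ 4 * u ^ 2 := by
    calc ∑ j ∈ Finset.range M, 1 / √(j : ℝ) ≤ ∑ j ∈ Finset.range (4 * N + 1), 1 / √(j : ℝ) :=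
          Finset.sum_le_sum_of_subset_of_nonneg (by
            intro j hj; rw [Finset.mem_range] at *; omega) fun j _ _ => hnn j
      _ ≤ 2 * √((4 * N : ℕ) : ℝ) := sum_one_div_sqrt_le _
      _ = 4 * u ^ 2 := by
          rw [← hs.sqrt_eq]
          push_cast
          rw [Real.sqrt_mul (by norm_num), show (4 : ℝ) = 2 ^ 2 by norm_num,
            Real.sqrt_sq (by norm_num)]
          ring
  have h4 : K / Real.log N * ∑ j ∈ Finset.range M, 1 / √(j : ℝ) ≤ K / Real.log N * (4 * u ^ 2) := by
    gcongr
  calc _ ≤ u ^ 2 / Real.log N + 4 * (u ^ 2 / Real.log N) + K / Real.log N * (4 * u ^ 2) := by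
        linarith
    _ = _ := by ring

/-! ### Lower bound for the probability of being near the origin. -/

theorem one_sub_sum_le_prod {ι : Type*} (s : Finset ι) (f x : ι → ℝ) (h0 : ∀ i ∈ s, 0 ≤ x i)
    (hf1 : ∀ i ∈ s, f i ≤ 1) (hf0 : ∀ i ∈ s, 0 ≤ f i) (hf : ∀ i ∈ s, 1 - x i ≤ f i) :
    1 - ∑ i ∈ s, x i ≤ ∏ i ∈ s, f i := by
  classical
  induction s using Finset.induction_on with
  | empty => simp
  | insert a s ha ih =>
    simp only [Finset.forall_mem_insert] at h0 hf1 hf0 hf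
    rw [Finset.sum_insert ha, Finset.prod_insert ha]
    have h1 := ih h0.2 hf1.2 hf0.2 hf.2
    have h2 := Finset.prod_le_one hf0.2 hf1.2
    have h3 := Finset.prod_nonneg hf0.2
    nlinarith [h0.1, hf1.1, hf0.1, hf.1]

theorem IsFourierBump.exists_re_ge {C : ℝ} {φ : ℝ → ℝ} {ψ : ℝ → ℂ} (h : IsFourierBump C φ ψ)
    {L : ℝ} (hL : 0 < L) :
    ∃ ε > 0, ∀ t x : ℝ, |t| ≤ ε → |x| ≤ L →
      (ψ 0).re / 2 ≤ (ψ t * Complex.exp (t * x * Complex.I)).re := by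
  set η := (ψ 0).re with hη
  have hη0 : 0 < η := h.re_pos
  obtain ⟨ε, hε, hcont⟩ := Metric.continuous_iff.1 h.continuous_fourier 0 (η / 4) (by positivity)
  have hψ0 : 0 < ‖ψ 0‖ := lt_of_lt_of_le hη0 (Complex.re_le_norm _)
  refine ⟨min (ε / 2) (η / (4 * (‖ψ 0‖ * L))), by positivity, fun t x ht hx => ?_⟩
  have h1 : ‖ψ t - ψ 0‖ ≤ η / 4 := by
    have := hcont t (by
      rw [Real.dist_eq, sub_zero]
      exact lt_of_le_of_lt (ht.trans (min_le_left _ _)) (by linarith))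
    rw [dist_eq_norm] at this
    exact this.le
  have h2 : ‖Complex.exp (t * x * Complex.I) - 1‖ ≤ |t| * |x| := by
    have := Real.norm_exp_I_mul_ofReal_sub_one_le (x := t * x)
    rw [Real.norm_eq_abs, abs_mul] at this
    convert this using 4
    push_cast; ring
  have h3 : ‖ψ 0‖ * (|t| * |x|) ≤ η / 4 := by
    calc ‖ψ 0‖ * (|t| * |x|) ≤ ‖ψ 0‖ * (η / (4 * (‖ψ 0‖ * L)) * L) := by
          gcongr
          exact ht.trans (min_le_right _ _)
      _ = η / 4 := by field_simp
  have h4 : ‖ψ t * Complex.exp (t * x * Complex.I) - ψ 0‖ ≤ η / 2 := by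
    have e : ψ t * Complex.exp (t * x * Complex.I) - ψ 0 =
        (ψ t - ψ 0) * Complex.exp (t * x * Complex.I) +
          ψ 0 * (Complex.exp (t * x * Complex.I) - 1) := by ring
    rw [e]
    refine (norm_add_le _ _).trans ?_
    rw [norm_mul, norm_mul, ← Complex.ofReal_mul, Complex.norm_exp_ofReal_mul_I, mul_one,
      Complex.ofReal_mul]
    have := mul_le_mul_of_nonneg_left h2 (norm_nonneg (ψ 0))
    linarith
  have h5 := (Complex.abs_re_le_norm _).trans h4
  rw [Complex.sub_re, abs_le] at h5
  linarith [h5.1]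

theorem logStep_mem_and_cos_nonneg {N m n : ℕ} {t : ℝ} (hl : 1 ≤ Real.log (4 * N))
    (hn : n ≤ 4 * N) (ht : |t| ≤ 1 / Real.log (4 * N)) {k : ℕ} (hk : k ∈ Finset.Ico m n) :
    0 ≤ logStep k ∧ logStep k ≤ Real.log (4 * N) ∧ 0 ≤ Real.cos (t * logStep k) := by
  rw [Finset.mem_Ico] at hk
  have hk2 : (k : ℝ) + 1 ≤ 4 * N := by
    have : k + 1 ≤ 4 * N := by omega
    exact_mod_cast this
  have h1 : 0 ≤ logStep k := Real.log_nonneg (by linarith [Nat.cast_nonneg (α := ℝ) k])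
  have h2 : logStep k ≤ Real.log (4 * N) := Real.log_le_log (by positivity) hk2
  refine ⟨h1, h2, ?_⟩
  have h3 : |t * logStep k| ≤ 1 := by
    rw [abs_mul, abs_of_nonneg h1]
    calc |t| * logStep k ≤ 1 / Real.log (4 * N) * Real.log (4 * N) := by gcongr
      _ = 1 := by field_simp
  rw [abs_le] at h3
  exact Real.cos_nonneg_of_mem_Icc ⟨by linarith [Real.pi_gt_three], by linarith [Real.pi_gt_three]⟩

/-- There are at most `4N` factors, each at least `1 - (t log (4N)) ^ 2 / 2 ≥ 1 - 1 / (8N)`, so the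
Weierstrass product inequality gives `1 / 2`. -/
theorem half_le_prod_cos {N m n : ℕ} {t : ℝ} (hN : 0 < N) (hl : 1 ≤ Real.log (4 * N))
    (hn : n ≤ 4 * N) (ht : |t| ≤ 1 / (2 * √(N : ℝ) * Real.log (4 * N))) :
    1 / 2 ≤ ∏ k ∈ Finset.Ico m n, Real.cos (t * logStep k) := by
  have hN1 : (1 : ℝ) ≤ N := by exact_mod_cast hN
  have hsN : 1 ≤ √(N : ℝ) := Real.one_le_sqrt.2 hN1
  have ht' : |t| ≤ 1 / Real.log (4 * N) := by
    refine ht.trans ?_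
    gcongr
    nlinarith
  have hk := fun k (hk : k ∈ Finset.Ico m n) => logStep_mem_and_cos_nonneg hl hn ht' hk
  have h1 := one_sub_sum_le_prod (Finset.Ico m n) (fun k => Real.cos (t * logStep k))
    (fun k => (t * logStep k) ^ 2 / 2) (fun _ _ => by positivity) (fun _ _ => Real.cos_le_one _)
    (fun k h => (hk k h).2.2) (fun _ _ => Real.one_sub_sq_div_two_le_cos)
  refine le_trans ?_ h1
  have h2 : ∑ k ∈ Finset.Ico m n, (t * logStep k) ^ 2 / 2 ≤
      ∑ k ∈ Finset.Ico m n, (|t| * Real.log (4 * N)) ^ 2 / 2 := by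
    refine Finset.sum_le_sum fun k h => ?_
    rw [← sq_abs, abs_mul, abs_of_nonneg (hk k h).1]
    have := (hk k h).1
    have := (hk k h).2.1
    gcongr
  have h3 : |t| * Real.log (4 * N) ≤ 1 / (2 * √(N : ℝ)) := by
    calc |t| * Real.log (4 * N) ≤ 1 / (2 * √(N : ℝ) * Real.log (4 * N)) * Real.log (4 * N) := by
          gcongr
      _ = 1 / (2 * √(N : ℝ)) := by field_simp
  have h4 : (|t| * Real.log (4 * N)) ^ 2 ≤ 1 / (4 * N) := by
    calc (|t| * Real.log (4 * N)) ^ 2 ≤ (1 / (2 * √(N : ℝ))) ^ 2 := by gcongr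
      _ = 1 / (4 * (N : ℝ)) := by
        rw [div_pow, mul_pow, Real.sq_sqrt (by positivity)]; norm_num
  have h5 : ((n - m : ℕ) : ℝ) ≤ 4 * N := by
    have : n - m ≤ 4 * N := by omega
    exact_mod_cast this
  simp only [Finset.sum_const, Nat.card_Ico, nsmul_eq_mul] at h2
  have h6 : ((n - m : ℕ) : ℝ) * ((|t| * Real.log (4 * N)) ^ 2 / 2) ≤ 4 * N * (1 / (4 * N) / 2) := by
    gcongr
  have h7 : 4 * (N : ℝ) * (1 / (4 * N) / 2) = 1 / 2 := by field_simp
  linarith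

theorem IsFourierBump.le_integral_increment {C : ℝ} {φ : ℝ → ℝ} {ψ : ℝ → ℂ}
    (h : IsFourierBump C φ ψ) (hY : ∀ k, IsRademacher (Y k) μ) (hi : iIndepFun Y μ)
    {L : ℝ} (hL : 0 < L) (m : ℕ) :
    ∀ᶠ N : ℕ in atTop, ∀ x : ℝ, |x| ≤ L → ∀ n : ℕ, 2 * N ≤ n → n ≤ 4 * N →
      (ψ 0).re / 24 / (√(N : ℝ) * Real.log N) ≤
        ∫ ω, φ (x + increment logStep Y m n ω) ∂μ := by
  obtain ⟨ε, hε, hre⟩ := h.exists_re_ge hL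
  set η := (ψ 0).re with hη
  have hη0 : 0 < η := h.re_pos
  set I := ∫ t, (‖ψ t‖ + 4 * (|t| * ‖ψ t‖)) with hI
  have hlogt : Tendsto (fun N : ℕ => Real.log (4 * N)) atTop atTop :=
    Real.tendsto_log_atTop.comp (tendsto_natCast_atTop_atTop.const_mul_atTop (by norm_num))
  have hut : Tendsto (fun N : ℕ => (N : ℝ) ^ (1 / 4 : ℝ)) atTop atTop :=
    (tendsto_rpow_atTop (by norm_num)).comp tendsto_natCast_atTop_atTop
  filter_upwards [eventually_isLargeScale, hlogt.eventually (eventually_ge_atTop (1 / ε)),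
    hut.eventually (eventually_ge_atTop (24 * I / η)), eventually_ge_atTop m]
    with N hs hNε hNI hmN x hx n hn1 hn2
  set u := (N : ℝ) ^ (1 / 4 : ℝ)
  have hN := hs.cast_pos
  have hN' : 0 < N := by exact_mod_cast hN
  have hl := hs.one_le_log_four_mul
  have hlN := hs.one_le_log
  have hu := hs.pos
  have hul := hs.large
  set τ := 1 / (2 * √(N : ℝ) * Real.log (4 * N)) with hτ
  have hsN : 0 < √(N : ℝ) := Real.sqrt_pos.2 hN
  have hτ0 : 0 < τ := by positivity
  have hτ1 : τ ≤ 1 / Real.log (4 * N) := by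
    have hsN1 : 1 ≤ √(N : ℝ) := Real.one_le_sqrt.2 (by exact_mod_cast hN')
    rw [hτ]
    gcongr
    nlinarith
  have hεl : 1 / Real.log (4 * N) ≤ ε := by
    rw [div_le_iff₀ (by linarith)]
    rwa [div_le_iff₀ hε, mul_comm] at hNε
  set F : ℝ → ℂ := fun t => ψ t * Complex.exp (t * x * Complex.I) *
    ((∏ k ∈ Finset.Ico m n, Real.cos (t * logStep k) : ℝ) : ℂ) with hF
  have hFint : Integrable F := by
    refine h.integrable.norm.mono' ?_ (Eventually.of_forall fun t => ?_)
    · have := h.continuous_fourier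
      refine Continuous.aestronglyMeasurable ?_
      simp only [hF]
      fun_prop
    · rw [hF, norm_mul_exp_mul_prod]
      exact mul_le_of_le_one_right (norm_nonneg _) (prod_abs_cos_le_one _ _)
  have hFre : ∀ t, (F t).re = (ψ t * Complex.exp (t * x * Complex.I)).re *
      ∏ k ∈ Finset.Ico m n, Real.cos (t * logStep k) := fun t => Complex.re_mul_ofReal _ _
  -- The integrand has real part at least `η / 4` for `|t| ≤ τ`, is still nonnegative there up to `1
  -- / log (4N)`, and costs at most the weight over `N` beyond.
  have hlow : ∀ t, (Set.Icc (-τ) τ).indicator (fun _ => η / 4) t -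
      (‖ψ t‖ + 4 * (|t| * ‖ψ t‖)) / N ≤ (F t).re := by
    intro t
    have hw : 0 ≤ (‖ψ t‖ + 4 * (|t| * ‖ψ t‖)) / N := by positivity
    by_cases h1 : |t| ≤ τ
    · have h2 := half_le_prod_cos (m := m) hN' hl hn2 h1
      have h3 := hre t x ((h1.trans hτ1).trans hεl) hx
      rw [Set.indicator_of_mem (by rwa [Set.mem_Icc, ← abs_le]), hFre]
      have : η / 2 * (1 / 2) ≤ (ψ t * Complex.exp (t * x * Complex.I)).re *
        ∏ k ∈ Finset.Ico m n, Real.cos (t * logStep k) :=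
        mul_le_mul h3 h2 (by norm_num) (by linarith)
      linarith
    rw [Set.indicator_of_notMem (by rwa [Set.mem_Icc, ← abs_le])]
    rcases le_total |t| (1 / Real.log (4 * N)) with h2 | h2
    · have h3 := hre t x (h2.trans hεl) hx
      have h4 : 0 ≤ ∏ k ∈ Finset.Ico m n, Real.cos (t * logStep k) :=
        Finset.prod_nonneg fun k hk => (logStep_mem_and_cos_nonneg hl hn2 h2 hk).2.2
      rw [hFre]
      have := mul_nonneg (by linarith : 0 ≤ (ψ t * Complex.exp (t * x * Complex.I)).re) h4
      linarith
    · have h3 : ‖F t‖ ≤ (‖ψ t‖ + 4 * (|t| * ‖ψ t‖)) / N := by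
        rw [hF, norm_mul_exp_mul_prod]
        -- Only the factors with index in `[N, 2N)` are kept, so the starting time `m ≤ N` does not
        -- matter.
        refine le_trans ?_ (mul_prod_abs_cos_le hs le_rfl (j := N) (by omega) ?_ h2
          (norm_nonneg (ψ t)))
        · refine mul_le_mul_of_nonneg_left ?_ (norm_nonneg _)
          exact Finset.prod_le_prod_of_subset_of_le_one
            (Finset.Ico_subset_Ico hmN (by omega)) (fun _ _ => abs_nonneg _)
            (fun _ _ _ => Real.abs_cos_le_one _)
        · rw [← hs.pow_eq]
          exact pow_le_pow_right₀ (by linarith) (by norm_num)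
      have h4 := (abs_le.1 ((Complex.abs_re_le_norm (F t)).trans h3)).1
      linarith
  have hEF : ∫ ω, φ (x + increment logStep Y m n ω) ∂μ = ∫ t, (F t).re := by
    have h1 := h.integral_increment hY hi logStep m n x
    have h2 : (∫ t, F t).re = ∫ t, (F t).re := (integral_re hFint).symm
    rw [← h2, ← h1, Complex.ofReal_re]
  rw [hEF]
  have hi1 : Integrable ((Set.Icc (-τ) τ).indicator fun _ : ℝ => η / 4) :=
    (integrable_indicator_iff measurableSet_Icc).2 (integrableOn_const (by simp))
  have hi2 := h.integrable_weight.div_const (N : ℝ)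
  have h1 := integral_mono (hi1.sub hi2) hFint.re hlow
  simp only [Pi.sub_apply] at h1
  rw [integral_sub hi1 hi2, integral_indicator_const _ measurableSet_Icc, integral_div, ← hI,
    measureReal_def, Real.volume_Icc, ENNReal.toReal_ofReal (by linarith), smul_eq_mul] at h1
  refine le_trans ?_ h1
  have h2 : 1 / (6 * (√(N : ℝ) * Real.log N)) ≤ τ := by
    rw [hτ]
    refine one_div_le_one_div_of_le (by positivity) ?_
    nlinarith [hs.log_four_mul_le]
  -- The error is at most half of the main term `η / 2 * τ`.
  have h3 : I / N ≤ η / 24 / (√(N : ℝ) * Real.log N) := by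
    rw [div_div, div_le_div_iff₀ hN (by positivity)]
    rw [div_le_iff₀ hη0] at hNI
    have h4 : √(N : ℝ) * Real.log N ≤ u ^ 3 := by
      rw [hs.sqrt_eq, pow_succ u 2]
      gcongr
      linarith [hs.log_mul_le]
    have hI0 : 0 ≤ I := integral_nonneg fun t => by positivity
    calc I * (24 * (√(N : ℝ) * Real.log N)) ≤ I * (24 * u ^ 3) := by gcongr
      _ = 24 * I * u ^ 3 := by ring
      _ ≤ u * η * u ^ 3 := by gcongr
      _ = η * N := by rw [← hs.pow_eq]; ring
  have h5 : (τ - -τ) * (η / 4) = η / 2 * τ := by ring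
  have h6 : η / 2 * (1 / (6 * (√(N : ℝ) * Real.log N))) ≤ η / 2 * τ := by gcongr
  have h7 : η / 2 * (1 / (6 * (√(N : ℝ) * Real.log N))) =
      2 * (η / 24 / (√(N : ℝ) * Real.log N)) := by
    field_simp
    norm_num
  linarith

end

/-! ### The second-moment method. -/

theorem sum_sum_le_two_mul (s : Finset ℕ) (f : ℕ → ℕ → ℝ) (hf : ∀ i j, 0 ≤ f i j)
    (hsymm : ∀ i j, f i j = f j i) :
    ∑ i ∈ s, ∑ j ∈ s, f i j ≤ 2 * ∑ i ∈ s, ∑ j ∈ s with i ≤ j, f i j := by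
  have h1 : ∑ i ∈ s, ∑ j ∈ s, f i j ≤
      ∑ i ∈ s, ∑ j ∈ s, ((if i ≤ j then f i j else 0) + (if j ≤ i then f j i else 0)) := by
    refine Finset.sum_le_sum fun i _ => Finset.sum_le_sum fun j _ => ?_
    have h2 := hf i j
    have h3 := hf j i
    rcases le_total i j with h | h
    · rw [if_pos h]; split_ifs <;> linarith
    · rw [if_pos h, hsymm i j]; split_ifs <;> linarith
  refine h1.trans (le_of_eq ?_)
  simp only [Finset.sum_add_distrib, Finset.sum_filter]
  rw [Finset.sum_comm (f := fun i j => if j ≤ i then f j i else 0)]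
  ring

section

variable {μ : Measure Ω} [IsProbabilityMeasure μ] {Y : ℕ → Ω → ℝ}

theorem IsFourierBump.integral_le_one {C : ℝ} {φ : ℝ → ℝ} {ψ : ℝ → ℂ} (h : IsFourierBump C φ ψ)
    {f : Ω → ℝ} (hf : Measurable f) : ∫ ω, φ (f ω) ∂μ ≤ 1 := by
  have := integral_mono (h.integrable_comp (μ := μ) hf) (integrable_const 1)
    (fun ω => h.le_one (f ω))
  simpa using this

/-- Each summand of the bound covers one range of `j`: the trivial bound at `0`, Littlewood-Offord
below `u ^ 3` (where `C < log N` makes every step exceed `C`), and the Fourier estimate above. -/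
theorem IsFourierBump.exists_integral_le_smallBallBound {C : ℝ} (hC : 0 ≤ C) {φ : ℝ → ℝ}
    {ψ : ℝ → ℂ} (h : IsFourierBump C φ ψ) (hY : ∀ k, IsRademacher (Y k) μ) (hi : iIndepFun Y μ) :
    ∃ K : ℝ, 0 < K ∧ ∀ (N n j : ℕ) (u y : ℝ), IsLargeScale N u → C < Real.log N → N ≤ n →
      n + j ≤ 4 * N →
      ∫ ω, φ (y + increment logStep Y n (n + j) ω) ∂μ ≤ smallBallBound N u K j := by
  obtain ⟨K, hK, hle⟩ := h.exists_integral_increment_le hY hi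
  refine ⟨K, hK, fun N n j u y hs hCN hn hnj => ?_⟩
  have hl := hs.one_le_log
  have hm : Measurable fun ω => y + increment logStep Y n (n + j) ω :=
    (measurable_increment hY logStep n (n + j)).const_add y
  have hlast : 0 ≤ K / Real.log N * (1 / √(j : ℝ)) := by positivity
  unfold smallBallBound
  rcases Nat.eq_zero_or_pos j with hj0 | hj0
  · have h1 := h.integral_le_one (μ := μ) hm
    rw [if_pos hj0]
    split_ifs
    · have : 0 ≤ 1 / √(j : ℝ) := by positivity
      linarith
    · linarith
  rw [if_neg hj0.ne']
  by_cases hju : (j : ℝ) < u ^ 3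
  · rw [if_pos hju]
    have h1 := h.integral_le_measureReal (μ := μ) hm
    have h2 := measureReal_abs_increment_le (b := logStep) hY hi hC (m := n) (n := n + j)
      (by omega) (fun k hk => lt_of_lt_of_le hCN (Real.log_le_log hs.cast_pos (by
        have : N ≤ k + 1 := by omega
        exact_mod_cast this))) y
    rw [Nat.add_sub_cancel_left] at h2
    linarith
  · rw [if_neg hju]
    have h1 := hle N n j u y hs hn hnj (not_lt.1 hju)
    have h2 : K / (√(j : ℝ) * Real.log N) = K / Real.log N * (1 / √(j : ℝ)) := by
      field_simp
    linarith

/-- The second moment of a sum of bumps is controlled by its first moment. -/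
theorem IsFourierBump.integral_sq_sum_le {C : ℝ} {φ : ℝ → ℝ} {ψ : ℝ → ℂ}
    (h : IsFourierBump C φ ψ) (hY : ∀ k, IsRademacher (Y k) μ) (hi : iIndepFun Y μ)
    (b : ℕ → ℝ) {m p r : ℕ} (hm : m ≤ p) {q : ℕ → ℝ} {D : ℝ}
    (hq : ∀ n j y, p ≤ n → n + j < r → ∫ ω, φ (y + increment b Y n (n + j) ω) ∂μ ≤ q j)
    (hD : ∀ M, M ≤ r → ∑ j ∈ Finset.range M, q j ≤ D) (x : ℝ) :
    ∫ ω, (∑ n ∈ Finset.Ico p r, φ (x + increment b Y m n ω)) ^ 2 ∂μ ≤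
      2 * D * ∫ ω, ∑ n ∈ Finset.Ico p r, φ (x + increment b Y m n ω) ∂μ := by
  set g : ℕ → Ω → ℝ := fun n ω => φ (x + increment b Y m n ω) with hg
  have hmeas : ∀ n, Measurable fun ω => x + increment b Y m n ω :=
    fun n => (measurable_increment hY b m n).const_add x
  have hgi : ∀ n, Integrable (g n) μ := fun n => h.integrable_comp (hmeas n)
  have hgm : ∀ n, Measurable (g n) := fun n => h.continuous.measurable.comp (hmeas n)
  have hg0 : ∀ n ω, 0 ≤ g n ω := fun n ω => h.nonneg _
  have hgg : ∀ n n', Integrable (fun ω => g n ω * g n' ω) μ := fun n n' =>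
    Integrable.of_bound ((hgm n).mul (hgm n')).aestronglyMeasurable 1
      (Eventually.of_forall fun ω => by
        rw [Real.norm_eq_abs, abs_of_nonneg (mul_nonneg (hg0 _ _) (hg0 _ _))]
        exact mul_le_one₀ (h.le_one _) (h.nonneg _) (h.le_one _))
  have e1 : ∫ ω, (∑ n ∈ Finset.Ico p r, g n ω) ^ 2 ∂μ =
      ∑ n ∈ Finset.Ico p r, ∑ n' ∈ Finset.Ico p r, ∫ ω, g n ω * g n' ω ∂μ := by
    simp only [sq, Finset.sum_mul_sum]
    rw [integral_finsetSum _ fun n _ => integrable_finsetSum _ fun n' _ => hgg n n']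
    exact Finset.sum_congr rfl fun n _ => integral_finsetSum _ fun n' _ => hgg n n'
  rw [e1, integral_finsetSum _ fun n _ => hgi n]
  refine (sum_sum_le_two_mul _ _ (fun n n' => integral_nonneg fun ω =>
    mul_nonneg (hg0 _ _) (hg0 _ _)) (fun n n' => by simp only [mul_comm])).trans ?_
  rw [mul_assoc]
  refine mul_le_mul_of_nonneg_left ?_ (by norm_num)
  rw [Finset.mul_sum]
  refine Finset.sum_le_sum fun n hn => ?_
  rw [Finset.mem_Ico] at hn
  have e2 : (Finset.Ico p r).filter (fun n' => n ≤ n') = Finset.Ico n r := by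
    ext n'; simp only [Finset.mem_filter, Finset.mem_Ico]; omega
  rw [e2, Finset.sum_Ico_eq_sum_range]
  have hgn : 0 ≤ ∫ ω, g n ω ∂μ := integral_nonneg fun ω => hg0 n ω
  calc ∑ j ∈ Finset.range (r - n), ∫ ω, g n ω * g (n + j) ω ∂μ
      ≤ ∑ j ∈ Finset.range (r - n), q j * ∫ ω, g n ω ∂μ := by
        refine Finset.sum_le_sum fun j hj => ?_
        rw [Finset.mem_range] at hj
        have h1 := h.integral_mul_le (measurable_increment hY b m n)
          (measurable_increment hY b n (n + j)) (indepFun_increment hY hi b m n (n + j))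
          (q := q j) (fun y => hq n j y hn.1 (by omega)) x
        simpa only [increment_add b Y (hm.trans hn.1) (Nat.le_add_right n j)] using h1
    _ = (∑ j ∈ Finset.range (r - n), q j) * ∫ ω, g n ω ∂μ := by rw [Finset.sum_mul]
    _ ≤ D * ∫ ω, g n ω ∂μ := mul_le_mul_of_nonneg_right (hD _ (Nat.sub_le _ _)) hgn

/-- Integrate the pointwise bound of the indicator of `A` from below by `1 - (1 - R / D) ^ 2`, which
vanishes where `R = 0`. -/
theorem div_le_measureReal_of_sq_le {R : Ω → ℝ} {A : Set Ω} (hA : MeasurableSet A)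
    (hR : Integrable R μ) (hR2 : Integrable (fun ω => R ω ^ 2) μ) {D : ℝ} (hD : 0 < D)
    (hsq : ∫ ω, R ω ^ 2 ∂μ ≤ D * ∫ ω, R ω ∂μ) (h0 : ∀ ω, ω ∉ A → R ω = 0) :
    (∫ ω, R ω ∂μ) / D ≤ μ.real A := by
  have h1 : ∀ ω, 2 / D * R ω - 1 / D ^ 2 * R ω ^ 2 ≤ A.indicator 1 ω := by
    intro ω
    by_cases hω : ω ∈ A
    · rw [Set.indicator_of_mem hω]
      have e : 2 / D * R ω - 1 / D ^ 2 * R ω ^ 2 = 1 - (1 - R ω / D) ^ 2 := by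
        field_simp; ring
      rw [e, Pi.one_apply]
      nlinarith [sq_nonneg (1 - R ω / D)]
    · rw [Set.indicator_of_notMem hω, h0 ω hω]
      simp
  have h2 := integral_mono ((hR.const_mul (2 / D)).sub (hR2.const_mul (1 / D ^ 2)))
    ((integrable_const (1 : ℝ)).indicator hA) h1
  simp only [Pi.sub_apply] at h2
  rw [integral_sub (hR.const_mul _) (hR2.const_mul _), integral_const_mul, integral_const_mul] at h2
  have h3 : ∫ ω, A.indicator (fun _ => (1 : ℝ)) ω ∂μ = μ.real A := by
    rw [integral_indicator_const _ hA]; simp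
  rw [h3] at h2
  have h4 : 1 / D ^ 2 * ∫ ω, R ω ^ 2 ∂μ ≤ 1 / D ^ 2 * (D * ∫ ω, R ω ∂μ) := by gcongr
  have h5 : 1 / D ^ 2 * (D * ∫ ω, R ω ∂μ) = (∫ ω, R ω ∂μ) / D := by field_simp
  have h6 : 2 / D * ∫ ω, R ω ∂μ = 2 * ((∫ ω, R ω ∂μ) / D) := by ring
  linarith

/-- From any bounded starting point, the walk visits `[-C, C]` in a suitable time window with
probability bounded below uniformly. -/
theorem exists_hitting_bound (hY : ∀ k, IsRademacher (Y k) μ) (hi : iIndepFun Y μ) {C : ℝ}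
    (hC : 0 < C) :
    ∃ δ > 0, ∀ (m : ℕ) (L : ℝ), 0 < L → ∃ M, m ≤ M ∧ ∀ x, |x| ≤ L →
      μ.real {ω | ∀ n, m < n → n ≤ M → C < |x + increment logStep Y m n ω|} ≤ 1 - δ := by
  obtain ⟨φ, ψ, h⟩ := exists_isFourierBump hC
  obtain ⟨K, hK, hle⟩ := h.exists_integral_le_smallBallBound hC.le hY hi
  set κ := (ψ 0).re / 24 with hκ
  have hκ0 : 0 < κ := by have := h.re_pos; positivity
  -- This is the lower bound for the mean of `R` divided by `2 * D`. The common factor `u ^ 2 / log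
  -- N` cancels, so `δ` depends on neither `m` nor `L`.
  refine ⟨κ / (5 + 4 * K), by positivity, fun m L hL => ?_⟩
  have hlogt : Tendsto (fun N : ℕ => Real.log N) atTop atTop :=
    Real.tendsto_log_atTop.comp tendsto_natCast_atTop_atTop
  obtain ⟨N, hs, hlow, hCN, hmN⟩ := (eventually_isLargeScale.and
    ((h.le_integral_increment hY hi hL m).and
      ((hlogt.eventually (eventually_gt_atTop C)).and (eventually_ge_atTop m)))).exists
  set u := (N : ℝ) ^ (1 / 4 : ℝ)
  have hN := hs.cast_pos
  have hN' : 0 < N := by exact_mod_cast hN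
  have hl := hs.one_le_log
  have hu := hs.pos
  refine ⟨4 * N, by omega, fun x hx => ?_⟩
  set R : Ω → ℝ := fun ω => ∑ n ∈ Finset.Ico (2 * N) (4 * N), φ (x + increment logStep Y m n ω)
    with hR
  set A : Set Ω := ⋃ n ∈ Finset.Ico (2 * N) (4 * N), {ω | |x + increment logStep Y m n ω| ≤ C}
    with hA
  have hmeas : ∀ n, Measurable fun ω => x + increment logStep Y m n ω :=
    fun n => (measurable_increment hY logStep m n).const_add x
  have hAm : MeasurableSet A :=
    Finset.measurableSet_biUnion _ fun n _ => measurableSet_le (hmeas n).abs measurable_const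
  have hRm : Measurable R :=
    Finset.measurable_sum _ fun n _ => h.continuous.measurable.comp (hmeas n)
  have hRi : Integrable R μ := integrable_finsetSum _ fun n _ => h.integrable_comp (hmeas n)
  have hRb : ∀ ω, |R ω| ≤ ((Finset.Ico (2 * N) (4 * N)).card : ℝ) := by
    intro ω
    rw [abs_of_nonneg (Finset.sum_nonneg fun n _ => h.nonneg _)]
    refine (Finset.sum_le_sum fun n _ => h.le_one _).trans ?_
    simp
  have hR2 : Integrable (fun ω => R ω ^ 2) μ := by
    refine Integrable.of_bound (hRm.pow_const 2).aestronglyMeasurable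
      (((Finset.Ico (2 * N) (4 * N)).card : ℝ) ^ 2) (Eventually.of_forall fun ω => ?_)
    rw [Real.norm_eq_abs, abs_pow]
    exact pow_le_pow_left₀ (abs_nonneg _) (hRb ω) 2
  set D := (5 + 4 * K) * (u ^ 2 / Real.log N) with hD
  have hD0 : 0 < D := by positivity
  have hsq := h.integral_sq_sum_le hY hi logStep (m := m) (p := 2 * N) (r := 4 * N) (by omega)
    (q := smallBallBound N u K) (D := D)
    (fun n j y hn hnj => hle N n j u y hs hCN (by omega) (by omega))
    (fun M hM => sum_smallBallBound_le hs hK hM) x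
  have h0 : ∀ ω, ω ∉ A → R ω = 0 := by
    intro ω hω
    refine Finset.sum_eq_zero fun n hn => ?_
    by_contra hne
    exact hω (Set.mem_biUnion (Finset.mem_coe.2 hn) (h.abs_le_of_ne_zero _ hne))
  have hPA := div_le_measureReal_of_sq_le hAm hRi hR2 (by positivity : 0 < 2 * D) hsq h0
  have hER : 2 * κ * (u ^ 2 / Real.log N) ≤ ∫ ω, R ω ∂μ := by
    rw [hR, integral_finsetSum _ fun n _ => h.integrable_comp (hmeas n)]
    have h1 := Finset.sum_le_sum fun n (hn : n ∈ Finset.Ico (2 * N) (4 * N)) =>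
      hlow x hx n (Finset.mem_Ico.1 hn).1 (Finset.mem_Ico.1 hn).2.le
    refine le_trans (le_of_eq ?_) h1
    rw [Finset.sum_const, Nat.card_Ico, nsmul_eq_mul, hs.sqrt_eq,
      show 4 * N - 2 * N = 2 * N by omega]
    have hl0 : Real.log N ≠ 0 := by positivity
    push_cast
    rw [← hκ]
    generalize Real.log N = l at hl0 ⊢
    rw [← hs.pow_eq]
    field_simp
  have hδ : κ / (5 + 4 * K) ≤ μ.real A := by
    refine le_trans ?_ hPA
    rw [le_div_iff₀ (by positivity)]
    refine le_trans (le_of_eq ?_) hER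
    rw [hD]
    field_simp
  have hsub : {ω | ∀ n, m < n → n ≤ 4 * N → C < |x + increment logStep Y m n ω|} ⊆ Aᶜ := by
    intro ω hω hωA
    simp only [hA, Set.mem_iUnion] at hωA
    obtain ⟨n, hn, hn2⟩ := hωA
    rw [Finset.mem_Ico] at hn
    exact absurd (hω n (by omega) hn.2.le) (not_lt.2 hn2)
  refine (measureReal_mono hsub).trans ?_
  rw [probReal_compl_eq_one_sub hAm]
  linarith

end

/-! ### Independent blocks and repeated attempts. -/

/-- The sequence `Y`, with the terms whose index lies outside `s` replaced by zero. -/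
noncomputable def truncate {Ω : Type*} (Y : ℕ → Ω → ℝ) (s : Finset ℕ) (ω : Ω) (k : ℕ) : ℝ :=
  if k ∈ s then Y k ω else 0

theorem increment_truncate {Ω : Type*} (b : ℕ → ℝ) (Y : ℕ → Ω → ℝ) {s : Finset ℕ} {m n : ℕ}
    (h : Finset.Ico m n ⊆ s) (ω : Ω) :
    increment b (fun k (v : ℕ → ℝ) => v k) m n (truncate Y s ω) = increment b Y m n ω :=
  Finset.sum_congr rfl fun k hk => by simp [truncate, h hk]

theorem measurable_truncate {μ : Measure Ω} {Y : ℕ → Ω → ℝ}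
    (hY : ∀ k, IsRademacher (Y k) μ) (s : Finset ℕ) :
    Measurable (truncate Y s) := by
  refine measurable_pi_lambda _ fun k => ?_
  unfold truncate
  split_ifs
  · exact (hY k).measurable
  · exact measurable_const

/-- Each truncation is a measurable function of a finite block of coordinates. Extending by zero
puts all blocks in the one space `ℕ → ℝ`. -/
theorem indepFun_truncate {μ : Measure Ω} {Y : ℕ → Ω → ℝ}
    (hY : ∀ k, IsRademacher (Y k) μ) (hi : iIndepFun Y μ)
    {s t : Finset ℕ} (hst : Disjoint s t) : IndepFun (truncate Y s) (truncate Y t) μ := by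
  have hext : ∀ s : Finset ℕ, Measurable fun (v : s → ℝ) (k : ℕ) =>
      if hk : k ∈ s then v ⟨k, hk⟩ else 0 := by
    intro s
    refine measurable_pi_lambda _ fun k => ?_
    split_ifs with hk
    · exact measurable_pi_apply _
    · exact measurable_const
  have h := (hi.indepFun_finset s t hst fun k => (hY k).measurable).comp (hext s) (hext t)
  convert h using 1 <;>
  · ext ω k
    simp only [truncate, Function.comp]
    split_ifs <;> rfl

theorem measurable_increment_coord (b : ℕ → ℝ) (m n : ℕ) :
    Measurable (increment b (fun k (v : ℕ → ℝ) => v k) m n) :=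
  Finset.measurable_sum _ fun k _ => (measurable_pi_apply k).const_mul _

section

variable {μ : Measure Ω} [IsProbabilityMeasure μ] {Y : ℕ → Ω → ℝ}

/-- Independence makes the joint law a product, so one may freeze `U = a` and integrate over `a ∈
B`. -/
theorem measureReal_le_of_indepFun {α β : Type*} [MeasurableSpace α] [MeasurableSpace β]
    {U : Ω → α} {V : Ω → β} (hU : Measurable U) (hV : Measurable V) (hi : IndepFun U V μ)
    {B : Set α} (hB : MeasurableSet B) {T : Set (α × β)} (hT : MeasurableSet T) {r : ℝ}
    (hr : ∀ a ∈ B, μ.real {ω | (a, V ω) ∈ T} ≤ r) :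
    μ.real {ω | U ω ∈ B ∧ (U ω, V ω) ∈ T} ≤ r * μ.real {ω | U ω ∈ B} := by
  have hmap := (indepFun_iff_map_prod_eq_prod_map_map hU.aemeasurable hV.aemeasurable).1 hi
  have : IsProbabilityMeasure (μ.map V) := Measure.isProbabilityMeasure_map hV.aemeasurable
  rcases B.eq_empty_or_nonempty with rfl | ⟨a₀, ha₀⟩
  · simp
  have hr0 : 0 ≤ r := measureReal_nonneg.trans (hr a₀ ha₀)
  have hE : MeasurableSet ((Prod.fst ⁻¹' B) ∩ T) := (measurable_fst hB).inter hT
  have e1 : μ {ω | U ω ∈ B ∧ (U ω, V ω) ∈ T} =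
      ((μ.map U).prod (μ.map V)) ((Prod.fst ⁻¹' B) ∩ T) := by
    rw [← hmap, Measure.map_apply (hU.prodMk hV) hE]
    rfl
  have h1 : μ {ω | U ω ∈ B ∧ (U ω, V ω) ∈ T} ≤ ENNReal.ofReal r * μ {ω | U ω ∈ B} := by
    rw [e1, Measure.prod_apply hE]
    calc ∫⁻ a, (μ.map V) (Prod.mk a ⁻¹' ((Prod.fst ⁻¹' B) ∩ T)) ∂(μ.map U)
        ≤ ∫⁻ a, B.indicator (fun _ => ENNReal.ofReal r) a ∂(μ.map U) := by
          refine lintegral_mono fun a => ?_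
          by_cases ha : a ∈ B
          · rw [Set.indicator_of_mem ha, Measure.map_apply hV (measurable_prodMk_left hE)]
            have h2 : V ⁻¹' (Prod.mk a ⁻¹' ((Prod.fst ⁻¹' B) ∩ T)) ⊆ {ω | (a, V ω) ∈ T} :=
              fun ω hω => hω.2
            refine (measure_mono h2).trans ?_
            rw [← ofReal_measureReal]
            exact ENNReal.ofReal_le_ofReal (hr a ha)
          · have h2 : Prod.mk a ⁻¹' ((Prod.fst ⁻¹' B) ∩ T) = (∅ : Set β) := by
              ext v; simp [ha]
            simp [h2]
      _ = ENNReal.ofReal r * μ {ω | U ω ∈ B} := by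
          rw [lintegral_indicator_const hB, Measure.map_apply hU hB]
          rfl
  have h3 := ENNReal.toReal_mono (by finiteness) h1
  rwa [ENNReal.toReal_mul, ENNReal.toReal_ofReal hr0] at h3

theorem exists_measureReal_no_visit_le (hY : ∀ k, IsRademacher (Y k) μ) (hi : iIndepFun Y μ)
    {C δ : ℝ} (b : ℕ → ℝ)
    (hδ : ∀ (m : ℕ) (L : ℝ), 0 < L → ∃ M, m ≤ M ∧ ∀ x, |x| ≤ L →
      μ.real {ω | ∀ n, m < n → n ≤ M → C < |x + increment b Y m n ω|} ≤ 1 - δ)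
    (m i : ℕ) :
    ∃ M, m ≤ M ∧ μ.real {ω | ∀ n, m < n → n ≤ M → C < |increment b Y 0 n ω|} ≤ (1 - δ) ^ i := by
  induction i with
  | zero => exact ⟨m, le_rfl, by simp⟩
  | succ i ih =>
    obtain ⟨M, hmM, hM⟩ := ih
    -- Almost surely `L` bounds the position at time `M`, so the hitting bound restarts there with
    -- the same `δ`. The `1` only ensures `0 < L`.
    set L := ∑ k ∈ Finset.Ico 0 M, |b k| + 1 with hLdef
    have hL : 0 < L := by
      have : 0 ≤ ∑ k ∈ Finset.Ico 0 M, |b k| := Finset.sum_nonneg fun _ _ => abs_nonneg _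
      linarith
    obtain ⟨M', hMM', hM'⟩ := hδ M L hL
    refine ⟨M', hmM.trans hMM', ?_⟩
    have hr0 : 0 ≤ 1 - δ := measureReal_nonneg.trans (hM' 0 (by simpa using hL.le))
    let co : ℕ → (ℕ → ℝ) → ℝ := fun k v => v k
    -- `B` describes the past: bounded at `M` and no visit so far. `T` forbids a visit in the next
    -- window, given past and future coordinates.
    let B : Set (ℕ → ℝ) := {v | |increment b co 0 M v| ≤ L} ∩
      ⋂ n ∈ Finset.Ioc m M, {v | C < |increment b co 0 n v|}
    let T : Set ((ℕ → ℝ) × (ℕ → ℝ)) :=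
      ⋂ n ∈ Finset.Ioc M M', {p | C < |increment b co 0 M p.1 + increment b co M n p.2|}
    have hB : MeasurableSet B := by
      refine (measurableSet_le (measurable_increment_coord b 0 M).abs measurable_const).inter ?_
      exact Finset.measurableSet_biInter _ fun n _ =>
        measurableSet_lt measurable_const (measurable_increment_coord b 0 n).abs
    have hT : MeasurableSet T := by
      refine Finset.measurableSet_biInter _ fun n _ => measurableSet_lt measurable_const ?_
      exact (((measurable_increment_coord b 0 M).comp measurable_fst).add
        ((measurable_increment_coord b M n).comp measurable_snd)).abs
    set U := truncate Y (Finset.Ico 0 M)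
    set V := truncate Y (Finset.Ico M M')
    have hUe : ∀ n ω, n ≤ M → increment b co 0 n (U ω) = increment b Y 0 n ω := fun n ω hn =>
      increment_truncate b Y (Finset.Ico_subset_Ico_right hn) ω
    have hVe : ∀ n ω, n ≤ M' → increment b co M n (V ω) = increment b Y M n ω := fun n ω hn =>
      increment_truncate b Y (Finset.Ico_subset_Ico_right hn) ω
    have key := measureReal_le_of_indepFun (r := 1 - δ)
      (measurable_truncate hY (Finset.Ico 0 M)) (measurable_truncate hY (Finset.Ico M M'))
      (indepFun_truncate hY hi (Finset.Ico_disjoint_Ico_consecutive 0 M M')) hB hT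
      (by
        intro a ha
        refine le_trans (measureReal_mono ?_) (hM' (increment b co 0 M a) ha.1)
        intro ω hω n hn1 hn2
        have h1 := Set.mem_iInter₂.1 hω n (Finset.mem_Ioc.2 ⟨hn1, hn2⟩)
        have h2 : C < |increment b co 0 M a + increment b co M n (V ω)| := h1
        rwa [hVe n ω hn2] at h2)
    have hbd : ∀ᵐ ω ∂μ, |increment b Y 0 M ω| ≤ L := by
      filter_upwards [ae_all_iff.2 fun k => (hY k).ae_eq_or] with ω hω
      have h1 : |increment b Y 0 M ω| ≤ ∑ k ∈ Finset.Ico 0 M, |b k| := by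
        refine (Finset.abs_sum_le_sum_abs _ _).trans (Finset.sum_le_sum fun k _ => ?_)
        rcases hω k with h | h <;> simp [h]
      linarith
    have h1 : μ.real {ω | ∀ n, m < n → n ≤ M' → C < |increment b Y 0 n ω|} ≤
        μ.real {ω | U ω ∈ B ∧ (U ω, V ω) ∈ T} := by
      refine ENNReal.toReal_mono (by finiteness) (measure_mono_ae ?_)
      filter_upwards [hbd] with ω hω hmem
      have hmem' : ∀ n, m < n → n ≤ M' → C < |increment b Y 0 n ω| := hmem
      refine ⟨⟨?_, ?_⟩, ?_⟩
      · have : |increment b co 0 M (U ω)| ≤ L := by rwa [hUe M ω le_rfl]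
        exact this
      · refine Set.mem_iInter₂.2 fun n hn => ?_
        rw [Finset.mem_Ioc] at hn
        have : C < |increment b co 0 n (U ω)| := by
          rw [hUe n ω hn.2]; exact hmem' n hn.1 (hn.2.trans hMM')
        exact this
      · refine Set.mem_iInter₂.2 fun n hn => ?_
        rw [Finset.mem_Ioc] at hn
        have : C < |increment b co 0 M (U ω) + increment b co M n (V ω)| := by
          rw [hUe M ω le_rfl, hVe n ω hn.2, increment_add b Y (Nat.zero_le _) hn.1.le]
          exact hmem' n (lt_of_le_of_lt hmM hn.1) hn.2
        exact this
    have h2 : μ.real {ω | U ω ∈ B} ≤ (1 - δ) ^ i := by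
      refine le_trans (measureReal_mono ?_) hM
      intro ω hω n hn1 hn2
      have h3 : C < |increment b co 0 n (U ω)| :=
        Set.mem_iInter₂.1 hω.2 n (Finset.mem_Ioc.2 ⟨hn1, hn2⟩)
      rwa [hUe n ω hn2] at h3
    calc _ ≤ _ := h1
      _ ≤ _ := key
      _ ≤ (1 - δ) * (1 - δ) ^ i := by gcongr
      _ = (1 - δ) ^ (i + 1) := by ring

theorem ae_frequently_abs_increment_le (hY : ∀ k, IsRademacher (Y k) μ) (hi : iIndepFun Y μ)
    {C : ℝ} (hC : 0 < C) :
    ∀ᵐ ω ∂μ, ∀ m, ∃ n, m < n ∧ |increment logStep Y 0 n ω| ≤ C := by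
  obtain ⟨δ, hδ, hhit⟩ := exists_hitting_bound hY hi hC
  rw [ae_all_iff]
  intro m
  have hr0 : 0 ≤ 1 - δ := by
    obtain ⟨M, -, hM⟩ := hhit 0 1 one_pos
    exact measureReal_nonneg.trans (hM 0 (by simp))
  have hle : ∀ i : ℕ, μ.real {ω | ∀ n, m < n → C < |increment logStep Y 0 n ω|} ≤ (1 - δ) ^ i := by
    intro i
    obtain ⟨M, -, hM⟩ := exists_measureReal_no_visit_le hY hi logStep hhit m i
    refine (measureReal_mono ?_).trans hM
    intro ω hω n hn _
    exact hω n hn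
  have hlim := tendsto_pow_atTop_nhds_zero_of_lt_one hr0 (by linarith : 1 - δ < 1)
  have h0 : μ.real {ω | ∀ n, m < n → C < |increment logStep Y 0 n ω|} = 0 :=
    le_antisymm (ge_of_tendsto' hlim hle) measureReal_nonneg
  rw [measureReal_eq_zero_iff] at h0
  rw [ae_iff]
  simpa using h0

end

/-! ### Return to the original walk. -/

theorem walk_eq_mul_increment {Ω : Type*} (c : ℝ) (X : ℕ → Ω → ℝ) (n : ℕ) (ω : Ω) :
    walk (fun k : ℕ => c * Real.log k) X n ω =
      c * increment logStep (fun k => X (k + 1)) 0 n ω := by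
  rw [walk, increment, Finset.mul_sum]
  have h := Finset.sum_Ico_add' (fun k : ℕ => c * Real.log k * X k ω) 0 n 1
  have h1 : Finset.Ico (0 + 1) (n + 1) = Finset.Icc 1 n := by
    ext k; simp only [Finset.mem_Ico, Finset.mem_Icc]; omega
  rw [h1] at h
  rw [← h]
  refine Finset.sum_congr rfl fun k _ => ?_
  simp only [logStep]
  push_cast
  ring

end AWalk

theorem mainTheorem7 {Ω : Type*} [MeasurableSpace Ω] (μ : Measure Ω) [IsProbabilityMeasure μ]
    (X : ℕ → Ω → ℝ) (hX : AWalk.IsRademacherSequence X μ) (c : ℝ) (hc : 0 < c) :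
    ∀ᵐ ω ∂μ, ∀ C : ℝ, 0 < C →
      AWalk.IsCRecurrent C (fun n => AWalk.walk (fun k : ℕ => c * Real.log k) X n ω) := by
  have hY : ∀ k, AWalk.IsRademacher (X (k + 1)) μ := fun k => hX.rademacher (k + 1) (by omega)
  -- The countably many thresholds `1 / (i + 1)` give one null set serving all real `C`.
  have h : ∀ᵐ ω ∂μ, ∀ i m : ℕ, ∃ n, m < n ∧
      |AWalk.increment AWalk.logStep (fun k => X (k + 1)) 0 n ω| ≤ 1 / ((i : ℝ) + 1) :=
    ae_all_iff.2 fun i => AWalk.ae_frequently_abs_increment_le hY hX.indep (by positivity)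
  filter_upwards [h] with ω hω C hC
  obtain ⟨i, hi⟩ := exists_nat_one_div_lt (div_pos hC hc)
  refine Set.infinite_of_forall_exists_gt fun m => ?_
  obtain ⟨n, hmn, hn⟩ := hω i m
  refine ⟨n, ?_, hmn⟩
  change |AWalk.walk (fun k : ℕ => c * Real.log k) X n ω| ≤ C
  rw [AWalk.walk_eq_mul_increment, abs_mul, abs_of_pos hc, mul_comm, ← le_div_iff₀ hc]
  exact hn.trans hi.le
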